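/- For a finite connected simple graph $H$ with at least two vertices, a finite simple graph $G$ and an integer $c\ge 1$, color the vertices of $G$ independently and uniformly with $c$ colors, $X_v$ being the color of $v$, and let $$T(H,G)=\frac1{|\mathrm{Aut}(H)|}\sum_{s}\ \prod_{(a,b)\in E(H)}\mathbf 1\{(s_a,s_b)\in E(G)\}\;\mathbf 1\{X_{s_a}=X_{s_b}\text{ for all }a,b\in V(H)\}$$ be the number of monochromatic copies of $H$ in $G$, where $s=(s_a)_{a\in V(H)}$ runs over the tuples of distinct vertices of $G$ indexed by $V(H)$. Below, $G_n$ is a sequence of finite simple graphs, $G_n$ is colored with $c_n$ colors, the $c_n$ are positive integers with $c_n\to\infty$, and $\lambda\ge 0$ (with $\mathrm{Poisson}(0)$ the point mass at $0$). **Theorem 1.2.** (1) Let $r\ge 1$ and let $K_{1,r}$ be the star with $r$ leaves. For every such sequence, $T(K_{1,r},G_n)$ converges in distribution to $\mathrm{Poisson}(\lambda)$ if and only if $$\lim_{n\to\infty}\mathbb E\,T(K_{1,r},G_n)=\lambda\quad\text{and}\quad\lim_{n\to\infty}\mathrm{Var}\,T(K_{1,r},G_n)=\lambda .$$ In that case all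 moments converge: $\mathbb E\,T(K_{1,r},G_n)^m\to\mathbb E Z^m$ for every integer $m\ge 0$, where $Z\sim\mathrm{Poisson}(\lambda)$. (2) Let $H$ be a finite connected simple graph with at least two vertices that is not isomorphic to any star $K_{1,r}$, $r\ge1$, and let $w$ be a vertex of $H$. Let $\mathcal P_n(H)$, the pyramid of $H$ of height $n$ with apex $w$, be the union of $n$ copies of $H$ that share all vertices except $w$, of which each has its own copy. Let $G_n(H)$ be the disjoint union of $\mathcal P_n(H)$ and $\lceil\lambda n\rceil$ disjoint copies of $H$. Then $|V(G_n(H))|\to\infty$, and there are positive integers $c_n\to\infty$ such that, when $G_n(H)$ is colored with $c_n$ colors, $T(H,G_n(H))$ converges in distribution to $\mathrm{Poisson}(\lambda)$, but $\mathbb E\,T(H,G_n(H))$ does not converge to $\lambda$. -/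

import Mathlib

open MeasureTheory ProbabilityTheory Filter Topology
open scoped NNReal

noncomputable section

namespace MonoCopies

universe u v

/-- The law of a uniformly random `c`-coloring of the vertex set `V`: the vertices receive
independent colors, each uniformly distributed on the set `Fin c` of `c` colors. -/
def coloring (V : Type v) [Fintype V] (c : ℕ+) : Measure (V → Fin c) :=
  Measure.pi fun _ => uniformOn (Set.univ : Set (Fin c))

instance (V : Type v) [Fintype V] (c : ℕ+) : IsProbabilityMeasure (coloring V c) := by
  unfold coloring
  infer_instance

open scoped Classical in
/-- The number `T(H, G)` of monochromatic copies of `H` in `G` under the coloring `X`: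
`(1 / |Aut H|) ∑_s ∏_{(a,b) ∈ E(H)} a_{s_a s_b}(G) 1{X is constant on s}`, where `s` runs over the
tuples of distinct vertices of `G` indexed by the vertices of `H`. -/
def T {W : Type u} [Fintype W] (H : SimpleGraph W) {V : Type v} [Fintype V] (G : SimpleGraph V)
    {c : ℕ+} (X : V → Fin c) : ℝ :=
  (1 / (Nat.card (H ≃g H) : ℝ)) *
    ∑ s : W ↪ V, (∏ e ∈ H.edgeFinset, if e.map s ∈ G.edgeSet then (1 : ℝ) else 0) *
      (if ∀ a b, X (s a) = X (s b) then 1 else 0)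

/-- `E T(H, G)` for a uniformly random `c`-coloring of `G`. -/
def mean {W : Type u} [Fintype W] (H : SimpleGraph W) {V : Type v} [Fintype V]
    (G : SimpleGraph V) (c : ℕ+) : ℝ :=
  ∫ X, T H G X ∂(coloring V c)

/-- `Var T(H, G)` for a uniformly random `c`-coloring of `G`. -/
def var {W : Type u} [Fintype W] (H : SimpleGraph W) {V : Type v} [Fintype V]
    (G : SimpleGraph V) (c : ℕ+) : ℝ :=
  variance (fun X => T H G X) (coloring V c)

/-- `E T(H, G)^m` for a uniformly random `c`-coloring of `G`. -/
def moment {W : Type u} [Fintype W] (H : SimpleGraph W) {V : Type v} [Fintype V]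
    (G : SimpleGraph V) (c : ℕ+) (m : ℕ) : ℝ :=
  ∫ X, T H G X ^ m ∂(coloring V c)

/-- `T(H, G_n)` converges in distribution to a Poisson random variable with mean `l`, where `G_n`
is colored uniformly at random with `c_n` colors. -/
def ConvergesToPoisson {W : Type u} [Fintype W] (H : SimpleGraph W) {V : ℕ → Type v}
    [∀ n, Fintype (V n)] (G : ∀ n, SimpleGraph (V n)) (c : ℕ → ℕ+) (l : ℝ≥0) : Prop :=
  TendstoInDistribution (fun n (X : V n → Fin (c n)) => T H (G n) X) atTop
    (fun k : ℕ => (k : ℝ)) (fun n => coloring (V n) (c n)) (poissonMeasure l)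

/-- The star `K_{1,r}`. -/
abbrev star (r : ℕ) : SimpleGraph (Fin 1 ⊕ Fin r) :=
  completeBipartiteGraph (Fin 1) (Fin r)

/-- The vertices of the pyramid of height `n`: the vertices of `H` other than the apex `w`,
together with `n` copies of `w`. -/
abbrev PyramidVertex {W : Type u} (w : W) (n : ℕ) : Type u := {x : W // x ≠ w} ⊕ Fin n

open scoped Classical in
/-- The map that sends the apex `w` to its `a`-th copy and fixes the other vertices of `H`. -/
def pyramidMap {W : Type u} (w : W) {n : ℕ} (a : Fin n) (x : W) : PyramidVertex w n :=
  if h : x = w then Sum.inr a else Sum.inl ⟨x, h⟩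

/-- The pyramid of `H` of height `n` with apex `w`: the union of `n` copies of `H` that share all
their vertices except `w`, of which each has its own copy. -/
def pyramid {W : Type u} (H : SimpleGraph W) (w : W) (n : ℕ) : SimpleGraph (PyramidVertex w n) :=
  ⨆ a : Fin n, H.map (pyramidMap w a)

/-- The disjoint union of `m` copies of `H`. -/
def copies {W : Type u} (H : SimpleGraph W) (m : ℕ) : SimpleGraph (Fin m × W) where
  Adj p q := p.1 = q.1 ∧ H.Adj p.2 q.2
  symm := ⟨fun _ _ h => ⟨h.1.symm, h.2.symm⟩⟩
  loopless := ⟨fun _ h => H.loopless.irrefl _ h.2⟩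

/-- The number of disjoint copies of `H` in `pyramidUnion`. -/
abbrev numCopies (l : ℝ≥0) (n : ℕ) : ℕ := ⌈(l : ℝ) * n⌉₊

/-- The disjoint union of the pyramid of `H` of height `n` with apex `w` and `⌈l n⌉` disjoint
copies of `H`. -/
def pyramidUnion {W : Type u} (H : SimpleGraph W) (w : W) (l : ℝ≥0) (n : ℕ) :
    SimpleGraph (PyramidVertex w n ⊕ (Fin (numCopies l n) × W)) :=
  (pyramid H w n).sum (copies H (numCopies l n))

open scoped Classical in
instance {W : Type u} [Fintype W] (w : W) (n : ℕ) : Fintype (PyramidVertex w n) :=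
  inferInstanceAs (Fintype ({x : W // x ≠ w} ⊕ Fin n))

end MonoCopies

end

/-! Monochromatic copies are treated as monochromatic members of an indexed family `A` of vertex
sets of size `r + 1 = |V(H)|`; different copies may have the same vertex set. Write N for their
number, μ for its mean, and D (`pairSum`) for the expected number of ordered pairs of distinct
monochromatic members with at least two common vertices.

Mean and variance imply Poisson, for every uniform family with `r ≥ 1`. Members with at most one
common vertex are uncorrelated, and those counted by D are positively correlated, so Var N - μ(1 -
c^(-r)) ≥ D/2 (`pairSum_le_variance`); hence D → 0. A Stein–Chen argument follows: conditioning on a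
member being monochromatic amounts to recoloring it with the color of one of its vertices, so (k+1)
P(N = k+1) is close to μ P(N = k) (`succ_mul_countProb_sub_le'`). Recoloring also disturbs members
that share a single vertex with the recolored one; taking the color from the vertex of largest
codegree and applying Cauchy–Schwarz (`sum_pairs_le`) bounds this effect by μ and D. The limiting
recursion characterizes the Poisson law (`tendsto_poisson_of_recursion`).

Poisson implies moments, for stars. Copies of a star that meet a given set are controlled by the
maximum degree Δ, and a vertex of degree Δ alone carries about Δ^r stars, so (Δ/c)^r = O(1 + μ)
(`exists_degree_bound`). This makes Var N of order at most μ(1 + μ)^((r-1)/r), while P(N = 0) stays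
away from 0; Chebyshev's inequality then bounds μ (`exists_mean_bound`). With Δ/c bounded, every
moment is bounded (`exists_moment_bound`), and domination gives convergence of moments.

Pyramids. The new apices form an independent set, so a copy of a non-star inside the pyramid uses
two base vertices (`copy_cases`). The base has bounded size, so its colors are distinct with
probability 1 - O(1/c) and the pyramid then contributes nothing. With c about n^(1/r) the disjoint
copies alone produce the Poisson limit, while the n copies in the pyramid add at least 1 to the
mean. -/

noncomputable section

namespace MonoCopies

open scoped Classical

set_option linter.unusedSectionVars false

/-! ### Averages over all colorings -/

section Average

variable {V : Type*} [Fintype V] {c : ℕ+}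

/-- The real-valued indicator of a proposition. -/
def ind (p : Prop) : ℝ := if p then 1 else 0

lemma ind_true {p : Prop} (h : p) : ind p = 1 := if_pos h

lemma ind_false {p : Prop} (h : ¬ p) : ind p = 0 := if_neg h

lemma ind_nonneg (p : Prop) : 0 ≤ ind p := by unfold ind; split_ifs <;> norm_num

lemma ind_le_one (p : Prop) : ind p ≤ 1 := by unfold ind; split_ifs <;> norm_num

lemma ind_mono {p q : Prop} (h : p → q) : ind p ≤ ind q := by
  by_cases hp : p
  · rw [ind_true hp, ind_true (h hp)]
  · rw [ind_false hp]; exact ind_nonneg q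

lemma ind_and (p q : Prop) : ind (p ∧ q) = ind p * ind q := by
  unfold ind; by_cases hp : p <;> by_cases hq : q <;> simp [hp, hq]

/-- The average of `f` over all colorings of `V` with `c` colors. -/
def avg (f : (V → Fin c) → ℝ) : ℝ := (∑ X, f X) / (c : ℝ) ^ Fintype.card V

lemma color_pos (c : ℕ+) : (0 : ℝ) < c := by exact_mod_cast c.pos

lemma one_le_color (c : ℕ+) : (1 : ℝ) ≤ c := by exact_mod_cast c.pos

lemma integral_coloring (f : (V → Fin c) → ℝ) : ∫ X, f X ∂(coloring V c) = avg f := by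
  rw [integral_fintype (Integrable.of_finite), avg, Finset.sum_div]
  refine Finset.sum_congr rfl fun X _ => ?_
  have : (coloring V c).real {X} = ((c : ℝ) ^ Fintype.card V)⁻¹ := by
    rw [Measure.real, coloring, Measure.pi_singleton]
    simp [uniformOn_univ]
  rw [this, smul_eq_mul]
  field_simp

lemma avg_add (f g : (V → Fin c) → ℝ) : avg (fun X => f X + g X) = avg f + avg g := by
  simp [avg, Finset.sum_add_distrib, add_div]

lemma avg_sub (f g : (V → Fin c) → ℝ) : avg (fun X => f X - g X) = avg f - avg g := by
  simp [avg, Finset.sum_sub_distrib, sub_div]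

lemma avg_const_mul (a : ℝ) (f : (V → Fin c) → ℝ) : avg (fun X => a * f X) = a * avg f := by
  simp [avg, ← Finset.mul_sum, mul_div_assoc]

lemma avg_const (a : ℝ) : avg (fun _ : V → Fin c => a) = a := by
  have := color_pos c
  simp [avg]

lemma avg_sum {ι : Type*} (s : Finset ι) (f : ι → (V → Fin c) → ℝ) :
    avg (fun X => ∑ i ∈ s, f i X) = ∑ i ∈ s, avg (f i) := by
  simp only [avg]
  rw [Finset.sum_comm, Finset.sum_div]

lemma avg_le_avg {f g : (V → Fin c) → ℝ} (h : ∀ X, f X ≤ g X) : avg f ≤ avg g := by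
  have := color_pos c
  unfold avg
  gcongr with X
  exact h X

lemma avg_nonneg {f : (V → Fin c) → ℝ} (h : ∀ X, 0 ≤ f X) : 0 ≤ avg f := by
  have := color_pos c
  exact div_nonneg (Finset.sum_nonneg fun X _ => h X) (by positivity)

lemma abs_avg_le (f : (V → Fin c) → ℝ) : |avg f| ≤ avg (fun X => |f X|) := by
  have := color_pos c
  rw [avg, avg, abs_div, abs_of_pos (by positivity : (0 : ℝ) < (c : ℝ) ^ Fintype.card V)]
  gcongr
  exact Finset.abs_sum_le_sum_abs _ _

end Average

/-! ### Conditioning on a monochromatic set by recoloring -/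

section Recolor

variable {V : Type*} [Fintype V] {c : ℕ+}

/-- The coloring `X` is constant on `A`. -/
def Mono {C : Type*} (X : V → C) (A : Finset V) : Prop := ∀ a ∈ A, ∀ b ∈ A, X a = X b

/-- Give all vertices of `A` the color of `u`. -/
def recolor {C : Type*} (X : V → C) (A : Finset V) (u : V) : V → C :=
  fun x => if x ∈ A then X u else X x

omit [Fintype V] in
lemma mono_iff {C : Type*} {X : V → C} {A : Finset V} {u : V} (hu : u ∈ A) :
    Mono X A ↔ ∀ a ∈ A, X a = X u :=
  ⟨fun h a ha => h a ha u hu, fun h a ha b hb => (h a ha).trans (h b hb).symm⟩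

/-- Given that `A` is monochromatic, a random coloring has the law of a random coloring in which the
color of `u` is spread over `A`. Both sides reduce to a sum over the colors outside `A.erase u`. -/
lemma avg_ind_mono_mul {A : Finset V} {u : V} (hu : u ∈ A) (g : (V → Fin c) → ℝ) :
    avg (fun X => ind (Mono X A) * g X) =
      ((c : ℝ) ^ (A.card - 1))⁻¹ * avg (fun X => g (recolor X A u)) := by
  set e := Equiv.piEquivPiSubtypeProd (fun x => x ∈ A.erase u) (fun _ : V => Fin c) with he
  have hc := color_pos c
  let ext (Y : {x // ¬ x ∈ A.erase u} → Fin c) : V → Fin c := fun x =>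
    if h : x ∈ A.erase u then Y ⟨u, by simp⟩ else Y ⟨x, h⟩
  have h1 : ∑ X, ind (Mono X A) * g X = ∑ Y, g (ext Y) := by
    rw [← e.symm.sum_comp, Fintype.sum_prod_type_right]
    refine Finset.sum_congr rfl fun Y _ => ?_
    -- Once the other colors `Y` are fixed, only one coloring of `A.erase u` makes `A`
    -- monochromatic.
    rw [Finset.sum_eq_single (fun _ => Y ⟨u, by simp⟩)]
    · have : e.symm (fun _ => Y ⟨u, by simp⟩, Y) = ext Y := by
        funext x
        simp [he, ext, Equiv.piEquivPiSubtypeProd]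
      rw [this, ind_true, one_mul]
      rw [mono_iff hu]
      intro a ha
      by_cases h : a = u
      · rw [h]
      · simp [ext, h, ha]
    · intro Z _ hZ
      rw [ind_false, zero_mul]
      contrapose! hZ
      funext x
      rw [mono_iff hu] at hZ
      have := hZ x (Finset.mem_of_mem_erase x.2)
      simpa [he, Equiv.piEquivPiSubtypeProd, (Finset.mem_erase.1 x.2).1,
        (Finset.mem_erase.1 x.2).2] using this
    · simp
  have h2 : ∑ X, g (recolor X A u) = (c : ℝ) ^ (A.card - 1) * ∑ Y, g (ext Y) := by
    rw [← e.symm.sum_comp, Fintype.sum_prod_type_right, Finset.mul_sum]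
    refine Finset.sum_congr rfl fun Y _ => ?_
    -- Recoloring forgets the colors `Z` on `A.erase u`, so each `Y` is counted `c ^ (A.card - 1)`
    -- times.
    have : ∀ Z, recolor (e.symm (Z, Y)) A u = ext Y := by
      intro Z
      funext x
      by_cases hx : x = u <;> by_cases hxA : x ∈ A <;>
        simp [he, ext, Equiv.piEquivPiSubtypeProd, recolor, hx, hxA]
    simp only [this, Finset.sum_const, nsmul_eq_mul]
    congr 1
    rw [← Finset.card_erase_of_mem hu, ← Fintype.card_coe]
    simp [-Finset.mem_erase, -Fintype.card_coe]
  rw [avg, avg, h1, h2]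
  field_simp

/-- The event that `B` is monochromatic is independent of the colors in `U` if `B` has at most
one vertex in common with `U`. -/
lemma avg_ind_mono_mul_of_disjoint {U B : Finset V} {u : V} (hu : u ∈ B)
    (hUB : Disjoint (B.erase u) U) {F : (V → Fin c) → ℝ}
    (hF : ∀ X Y : V → Fin c, (∀ x ∈ U, X x = Y x) → F X = F Y) :
    avg (fun X => ind (Mono X B) * F X) = ((c : ℝ) ^ (B.card - 1))⁻¹ * avg F := by
  rw [avg_ind_mono_mul hu]
  congr 2
  funext X
  apply hF
  intro x hx
  unfold recolor
  split_ifs with h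
  · by_cases hxu : x = u
    · rw [hxu]
    · exact absurd hx (Finset.disjoint_left.1 hUB (Finset.mem_erase.2 ⟨hxu, h⟩))
  · rfl

lemma avg_ind_mono {B : Finset V} (hB : B.Nonempty) :
    avg (fun X : V → Fin c => ind (Mono X B)) = ((c : ℝ) ^ (B.card - 1))⁻¹ := by
  obtain ⟨u, hu⟩ := hB
  have := avg_ind_mono_mul_of_disjoint (c := c) (U := ∅) hu (by simp) (F := fun _ => 1)
    (fun _ _ _ => rfl)
  simpa [avg_const] using this

/-- The conditional probability that `B` is monochromatic given that `U` is, if `U` is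
nonempty. -/
def wt (c : ℕ+) (U B : Finset V) : ℝ := ((c : ℝ) ^ (B.card - max (B ∩ U).card 1))⁻¹

omit [Fintype V] in
lemma wt_pos (U B : Finset V) : 0 < wt c U B := by
  have := color_pos c
  unfold wt; positivity

omit [Fintype V] in
lemma inv_pow_le_inv_pow {a b : ℕ} (h : a ≤ b) : ((c : ℝ) ^ b)⁻¹ ≤ ((c : ℝ) ^ a)⁻¹ := by
  have := color_pos c
  have := one_le_color c
  gcongr

omit [Fintype V] in
lemma inv_pow_le_wt (U B : Finset V) : ((c : ℝ) ^ (B.card - 1))⁻¹ ≤ wt c U B :=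
  inv_pow_le_inv_pow (by omega)

-- Once `U` is monochromatic, one vertex `u` of `B ∩ U` represents all of them, so `B' = {u} ∪ (B \
-- U)` decides whether `B` is monochromatic. It meets `U` in at most one vertex, which makes it
-- independent of the colors on `U`. If `B ∩ U` is empty, `B' = B` and `u` is arbitrary; this is the
-- case covered by the `max` with 1.
omit [Fintype V] in
lemma exists_core (U : Finset V) {B : Finset V} (hB : B.Nonempty) :
    ∃ u ∈ B, ∃ B' : Finset V, u ∈ B' ∧ B' ⊆ B ∧ B \ U ⊆ B' ∧ Disjoint (B'.erase u) U ∧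
      B'.card - 1 = B.card - max (B ∩ U).card 1 ∧ (u ∈ U ∨ B ∩ U = ∅) := by
  have hcard := Finset.card_sdiff_add_card_inter B U
  rcases (B ∩ U).eq_empty_or_nonempty with h | ⟨u, hu⟩
  · obtain ⟨u, hu⟩ := hB
    refine ⟨u, hu, B, hu, subset_rfl, Finset.sdiff_subset, ?_, by simp [h], Or.inr h⟩
    exact (Finset.disjoint_iff_inter_eq_empty.2 h).mono_left (Finset.erase_subset _ _)
  · obtain ⟨huB, huU⟩ := Finset.mem_inter.1 hu
    refine ⟨u, huB, insert u (B \ U), Finset.mem_insert_self _ _, ?_, Finset.subset_insert _ _,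
      ?_, ?_, Or.inl huU⟩
    · exact Finset.insert_subset huB Finset.sdiff_subset
    · rw [Finset.erase_insert (by simp [huU])]
      exact Finset.sdiff_disjoint
    · rw [Finset.card_insert_of_notMem (by simp [huU])]
      have : 0 < (B ∩ U).card := Finset.card_pos.2 ⟨u, hu⟩
      omega

lemma avg_ind_mono_mul_le {U B : Finset V} (hB : B.Nonempty) {F : (V → Fin c) → ℝ}
    (hF : ∀ X Y : V → Fin c, (∀ x ∈ U, X x = Y x) → F X = F Y) (hF0 : ∀ X, 0 ≤ F X) :
    avg (fun X => ind (Mono X B) * F X) ≤ wt c U B * avg F := by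
  obtain ⟨u, -, B', huB', hB'B, -, hd, hcard, -⟩ := exists_core U hB
  rw [wt, ← hcard, ← avg_ind_mono_mul_of_disjoint huB' hd hF]
  refine avg_le_avg fun X => mul_le_mul_of_nonneg_right (ind_mono ?_) (hF0 X)
  exact fun h a ha b hb => h a (hB'B ha) b (hB'B hb)

lemma avg_ind_mono_mul_ind_mono {U B : Finset V} (hU : U.Nonempty) (hB : B.Nonempty) :
    avg (fun X : V → Fin c => ind (Mono X B) * ind (Mono X U)) =
      ((c : ℝ) ^ (U.card - 1))⁻¹ * wt c U B := by
  obtain ⟨u, -, B', huB', hB'B, hBB', hd, hcard, hu⟩ := exists_core U hB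
  rw [wt, ← hcard, ← avg_ind_mono hU, mul_comm,
    ← avg_ind_mono_mul_of_disjoint huB' hd (F := fun X => ind (Mono X U))]
  · congr 1
    funext X
    rw [← ind_and, ← ind_and]
    congr 1
    refine propext (and_congr_left fun hXU =>
      ⟨fun h a ha b hb => h a (hB'B ha) b (hB'B hb), fun h => ?_⟩)
    have key : ∀ a ∈ B, X a = X u := by
      intro a ha
      by_cases haU : a ∈ U
      · rcases hu with hu | hu
        · exact hXU a haU u hu
        · exact absurd (Finset.mem_inter.2 ⟨ha, haU⟩) (by simp [hu])
      · exact h a (hBB' (Finset.mem_sdiff.2 ⟨ha, haU⟩)) u huB'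
    exact fun a ha b hb => (key a ha).trans (key b hb).symm
  · intro X Y h
    congr 1
    exact propext ⟨fun hX a ha b hb => by rw [← h a ha, ← h b hb]; exact hX a ha b hb,
      fun hX a ha b hb => by rw [h a ha, h b hb]; exact hX a ha b hb⟩

lemma avg_ind_mono_recolor {U B : Finset V} {u : V} (hu : u ∈ U) (hB : B.Nonempty) :
    avg (fun X : V → Fin c => ind (Mono (recolor X U u) B)) = wt c U B := by
  have h1 := avg_ind_mono_mul_ind_mono (c := c) ⟨u, hu⟩ hB
  simp_rw [mul_comm (ind (Mono _ B))] at h1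
  rw [avg_ind_mono_mul hu] at h1
  have := color_pos c
  exact mul_left_cancel₀ (by positivity) h1

end Recolor

/-! ### First and second moments for uniform families of sets -/

section Hypergraph

variable {V ι : Type*} [Fintype V] [Fintype ι] {r : ℕ}

/-- The number of monochromatic members of the family `A`. -/
def count {C : Type*} (A : ι → Finset V) (X : V → C) : ℕ :=
  (Finset.univ.filter fun i => Mono X (A i)).card

/-- The expected number of monochromatic members of the family `A`. -/
def countMean (A : ι → Finset V) (c : ℕ+) : ℝ := avg fun X : V → Fin c => (count A X : ℝ)

/-- The probability that exactly `k` members of the family `A` are monochromatic. -/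
def countProb (A : ι → Finset V) (c : ℕ+) (k : ℕ) : ℝ :=
  avg fun X : V → Fin c => ind (count A X = k)

/-- The expected number of ordered pairs of distinct monochromatic members of `A` with at least
two common vertices. -/
def pairSum (A : ι → Finset V) (c : ℕ+) : ℝ :=
  ∑ i, ∑ j, if j ≠ i ∧ 2 ≤ (A j ∩ A i).card then
    ((c : ℝ) ^ ((A i).card - 1))⁻¹ * wt c (A i) (A j) else 0

lemma count_cast {C : Type*} (A : ι → Finset V) (X : V → C) :
    (count A X : ℝ) = ∑ i, ind (Mono X (A i)) := by
  simp [count, ind]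

variable {A : ι → Finset V} {c : ℕ+}

lemma nonempty_of_card (hA : ∀ i, (A i).card = r + 1) (i : ι) : (A i).Nonempty :=
  Finset.card_pos.1 (by rw [hA]; omega)

lemma countMean_eq (hA : ∀ i, (A i).card = r + 1) :
    countMean A c = Fintype.card ι * ((c : ℝ) ^ r)⁻¹ := by
  simp_rw [countMean, count_cast]
  rw [avg_sum]
  simp [avg_ind_mono (nonempty_of_card hA _), hA]

lemma avg_count_sq (hA : ∀ i, (A i).card = r + 1) :
    avg (fun X : V → Fin c => (count A X : ℝ) ^ 2) =
      ∑ i, ∑ j, ((c : ℝ) ^ r)⁻¹ * wt c (A i) (A j) := by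
  simp_rw [count_cast, sq, Finset.sum_mul_sum]
  rw [avg_sum]
  simp_rw [avg_sum]
  rw [Finset.sum_comm]
  refine Finset.sum_congr rfl fun i _ => Finset.sum_congr rfl fun j _ => ?_
  rw [avg_ind_mono_mul_ind_mono (nonempty_of_card hA i) (nonempty_of_card hA j), hA]
  rfl

lemma wt_self (hA : ∀ i, (A i).card = r + 1) (i : ι) : wt c (A i) (A i) = 1 := by
  simp [wt, hA]

/-- Two common vertices save at least one factor `c` compared with the independent case, and `c ≥
2`. -/
lemma two_mul_le_wt (hA : ∀ i, (A i).card = r + 1) (hc : 2 ≤ (c : ℕ)) {i j : ι}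
    (h : 2 ≤ (A j ∩ A i).card) : 2 * ((c : ℝ) ^ r)⁻¹ ≤ wt c (A i) (A j) := by
  have hc' : (2 : ℝ) ≤ (c : ℝ) := by exact_mod_cast hc
  have h0 := color_pos c
  have hle : (A j ∩ A i).card ≤ r + 1 := by
    rw [← hA j]; exact Finset.card_le_card Finset.inter_subset_left
  obtain ⟨m, hm⟩ : ∃ m, r = (r + 1 - max (A j ∩ A i).card 1) + 1 + m :=
    Nat.exists_eq_add_of_le (by omega)
  rw [wt, hA]
  set s := r + 1 - max (A j ∩ A i).card 1
  have h1 : ((c : ℝ) ^ r)⁻¹ ≤ ((c : ℝ) ^ (s + 1))⁻¹ := inv_pow_le_inv_pow (by omega)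
  have h2 : 2 * ((c : ℝ) ^ (s + 1))⁻¹ ≤ ((c : ℝ) ^ s)⁻¹ := by
    rw [pow_succ, mul_inv]
    have : 2 * (c : ℝ)⁻¹ ≤ 1 := by rw [← div_eq_mul_inv]; exact (div_le_one h0).2 hc'
    have hp : 0 ≤ ((c : ℝ) ^ s)⁻¹ := by positivity
    nlinarith
  linarith

lemma wt_of_card_le_one (hA : ∀ i, (A i).card = r + 1) {i j : ι}
    (h : ¬ 2 ≤ (A j ∩ A i).card) : wt c (A i) (A j) = ((c : ℝ) ^ r)⁻¹ := by
  rw [wt, hA, max_eq_right (by omega), Nat.add_sub_cancel]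

lemma inv_pow_le_wt' (hA : ∀ i, (A i).card = r + 1) (i j : ι) :
    ((c : ℝ) ^ r)⁻¹ ≤ wt c (A i) (A j) := by
  simpa [hA] using inv_pow_le_wt (c := c) (A i) (A j)

lemma countMean_sq (hA : ∀ i, (A i).card = r + 1) :
    countMean A c ^ 2 = ∑ _i : ι, ∑ _j : ι, ((c : ℝ) ^ r)⁻¹ * ((c : ℝ) ^ r)⁻¹ := by
  rw [countMean_eq hA]
  simp
  ring

lemma pairSum_nonneg : 0 ≤ pairSum A c := by
  have := color_pos c
  refine Finset.sum_nonneg fun i _ => Finset.sum_nonneg fun j _ => ?_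
  have := wt_pos (c := c) (A i) (A j)
  split_ifs <;> positivity

/-- The covariance of two indicators is `c^(-r) (wt - c^(-r))`. It is 0 for at most one common
vertex, at least half of `c^(-r) wt` for two or more, and on the diagonal it gives the term with the
mean. -/
lemma pairSum_le_variance (hA : ∀ i, (A i).card = r + 1) (hc : 2 ≤ (c : ℕ)) :
    pairSum A c / 2 + countMean A c * (1 - ((c : ℝ) ^ r)⁻¹) ≤
      avg (fun X : V → Fin c => (count A X : ℝ) ^ 2) - countMean A c ^ 2 := by
  have h0 := color_pos c
  rw [avg_count_sq hA, countMean_sq hA, countMean_eq hA, pairSum, ← Finset.sum_sub_distrib]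
  have : (Fintype.card ι : ℝ) * ((c : ℝ) ^ r)⁻¹ * (1 - ((c : ℝ) ^ r)⁻¹) =
      ∑ i : ι, ∑ j : ι, if j = i then ((c : ℝ) ^ r)⁻¹ * (1 - ((c : ℝ) ^ r)⁻¹) else 0 := by
    simp; ring
  rw [this, Finset.sum_div, ← Finset.sum_add_distrib]
  refine Finset.sum_le_sum fun i _ => ?_
  rw [Finset.sum_div, ← Finset.sum_add_distrib, ← Finset.sum_sub_distrib]
  refine Finset.sum_le_sum fun j _ => ?_
  have hq : 0 < ((c : ℝ) ^ r)⁻¹ := by positivity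
  have hw := inv_pow_le_wt' (c := c) hA i j
  by_cases hij : j = i
  · subst hij
    simp [wt_self hA]
    linarith
  · by_cases h2 : 2 ≤ (A j ∩ A i).card
    · have := two_mul_le_wt hA hc h2
      simp only [ne_eq, hij, not_false_eq_true, h2, and_self, if_true, if_false, hA,
        Nat.add_sub_cancel]
      nlinarith
    · simp only [ne_eq, hij, not_false_eq_true, h2, and_false, if_false]
      nlinarith

lemma variance_le_sum (hA : ∀ i, (A i).card = r + 1) :
    avg (fun X : V → Fin c => (count A X : ℝ) ^ 2) - countMean A c ^ 2 ≤
      ∑ i, ∑ j, if 2 ≤ (A j ∩ A i).card then ((c : ℝ) ^ r)⁻¹ * wt c (A i) (A j) else 0 := by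
  have h0 := color_pos c
  rw [avg_count_sq hA, countMean_sq hA, ← Finset.sum_sub_distrib]
  refine Finset.sum_le_sum fun i _ => ?_
  rw [← Finset.sum_sub_distrib]
  refine Finset.sum_le_sum fun j _ => ?_
  split_ifs with h
  · have : 0 < ((c : ℝ) ^ r)⁻¹ := by positivity
    nlinarith
  · rw [wt_of_card_le_one hA h, sub_self]

/-- Chebyshev's inequality: where the count is 0, its squared deviation is the square of the mean.
-/
lemma sq_mul_countProb_zero_le :
    countMean A c ^ 2 * countProb A c 0 ≤
      avg (fun X : V → Fin c => (count A X : ℝ) ^ 2) - countMean A c ^ 2 := by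
  have h : avg (fun X : V → Fin c => (count A X : ℝ) ^ 2) - countMean A c ^ 2 =
      avg (fun X : V → Fin c => ((count A X : ℝ) - countMean A c) ^ 2) := by
    have : ∀ X : V → Fin c, ((count A X : ℝ) - countMean A c) ^ 2 =
        ((count A X : ℝ) ^ 2 - (2 * countMean A c) * (count A X : ℝ)) + countMean A c ^ 2 := by
      intro X; ring
    simp_rw [this]
    rw [avg_add, avg_sub, avg_const_mul, avg_const]
    change _ = _ - 2 * countMean A c * countMean A c + _
    ring
  rw [h, countProb, ← avg_const_mul]
  refine avg_le_avg fun X => ?_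
  by_cases hX : count A X = 0
  · simp [hX, ind]
  · rw [ind_false hX, mul_zero]; positivity

/-- The number of members of the family `A` that contain `x`. -/
def codeg (A : ι → Finset V) (x : V) : ℕ := (Finset.univ.filter fun i => x ∈ A i).card

lemma sum_codeg (hA : ∀ i, (A i).card = r + 1) :
    ∑ x, (codeg A x : ℝ) = (r + 1) * Fintype.card ι := by
  have := Finset.sum_card_bipartiteAbove_eq_sum_card_bipartiteBelow
    (s := (Finset.univ : Finset V)) (t := (Finset.univ : Finset ι)) (fun x i => x ∈ A i)
  simp only [Finset.bipartiteAbove, Finset.bipartiteBelow, Finset.filter_univ_mem, hA,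
    Finset.sum_const, Finset.card_univ, smul_eq_mul] at this
  have h2 : ∑ x, codeg A x = Fintype.card ι * (r + 1) := this
  rw [mul_comm]
  exact_mod_cast h2

/-- The union of two members with two common vertices has at most `2 * r` vertices, so each such
pair of distinct members contributes at least `c^(-(2r-1))` to `pairSum`. The diagonal accounts for
the other summand. -/
lemma card_pairs_le (hr : 1 ≤ r) (hA : ∀ i, (A i).card = r + 1) :
    ∑ i, ∑ j, (if 2 ≤ (A j ∩ A i).card then (1 : ℝ) else 0) ≤
      Fintype.card ι + pairSum A c * (c : ℝ) ^ (2 * r - 1) := by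
  have h0 := color_pos c
  have : (Fintype.card ι : ℝ) = ∑ i : ι, ∑ j : ι, if j = i then (1 : ℝ) else 0 := by simp
  rw [this, pairSum, Finset.sum_mul, ← Finset.sum_add_distrib]
  refine Finset.sum_le_sum fun i _ => ?_
  rw [Finset.sum_mul, ← Finset.sum_add_distrib]
  refine Finset.sum_le_sum fun j _ => ?_
  have hw := wt_pos (c := c) (A i) (A j)
  by_cases hij : j = i
  · subst hij
    have : (if 2 ≤ (A j ∩ A j).card then (1 : ℝ) else 0) ≤ 1 := by split_ifs <;> norm_num
    simpa using this
  · by_cases h2 : 2 ≤ (A j ∩ A i).card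
    · simp only [ne_eq, hij, not_false_eq_true, h2, and_self, if_true, if_false, hA,
        Nat.add_sub_cancel, zero_add]
      have h3 : ((c : ℝ) ^ (r - 1))⁻¹ ≤ wt c (A i) (A j) :=
        inv_pow_le_inv_pow (by rw [hA]; omega)
      have h4 : (c : ℝ) ^ (2 * r - 1) = c ^ r * c ^ (r - 1) := by
        rw [← pow_add]; congr 1; omega
      calc (1 : ℝ) = ((c : ℝ) ^ r)⁻¹ * ((c : ℝ) ^ (r - 1))⁻¹ * (c : ℝ) ^ (2 * r - 1) := by
            rw [h4]; field_simp
        _ ≤ _ := by gcongr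
    · simp [hij, h2]

lemma ite_mul_ite_eq_ite_and (p q : Prop) [Decidable p] [Decidable q] :
    ((if p then 1 else 0) * if q then 1 else 0 : ℝ) = if p ∧ q then 1 else 0 := by
  by_cases hp : p <;> by_cases hq : q <;> simp [hp, hq]

/-- Maximality of `u i` gives codeg x ≤ √(codeg x · codeg (u i)), so the sum is at most the sum over
ordered pairs (x, y) of n(x, y) √(codeg x · codeg y), where n(x, y) counts the members containing
both of two distinct vertices. In Cauchy–Schwarz, Σ codeg x · codeg y is the square of the sum of
codegrees, and Σ n² counts pairs of members with two marked common vertices. -/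
lemma sum_pairs_le (hr : 1 ≤ r) (hA : ∀ i, (A i).card = r + 1) {u : ι → V}
    (hu : ∀ i, u i ∈ A i) (hmax : ∀ i, ∀ x ∈ A i, codeg A x ≤ codeg A (u i)) :
    (∑ i, ∑ x ∈ (A i).erase (u i), (codeg A x : ℝ)) ^ 2 ≤
      (r + 1) ^ 4 * (Fintype.card ι : ℝ) ^ 2 *
        (Fintype.card ι + pairSum A c * (c : ℝ) ^ (2 * r - 1)) := by
  set g : V × V → ℝ := fun p => √(codeg A p.1) * √(codeg A p.2) with hg
  set n : V × V → ℝ := fun p => ∑ i, if p.1 ≠ p.2 ∧ p.1 ∈ A i ∧ p.2 ∈ A i then 1 else 0 with hn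
  have h1 : ∑ i, ∑ x ∈ (A i).erase (u i), (codeg A x : ℝ) ≤ ∑ p, n p * g p := by
    simp_rw [hn, Finset.sum_mul]
    rw [Finset.sum_comm]
    refine Finset.sum_le_sum fun i _ => ?_
    have : ∑ x ∈ (A i).erase (u i), (codeg A x : ℝ) ≤
        ∑ p ∈ ((A i).erase (u i)).map ⟨fun x => (x, u i), fun x y h => (Prod.mk.inj h).1⟩, g p := by
      rw [Finset.sum_map]
      refine Finset.sum_le_sum fun x hx => ?_
      have hx' := hmax i x (Finset.mem_of_mem_erase hx)
      calc (codeg A x : ℝ) = √(codeg A x) * √(codeg A x) := by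
            rw [Real.mul_self_sqrt (Nat.cast_nonneg _)]
        _ ≤ √(codeg A x) * √(codeg A (u i)) := by gcongr
    refine this.trans ?_
    simp_rw [ite_mul, one_mul, zero_mul]
    rw [← Finset.sum_filter]
    refine Finset.sum_le_sum_of_subset_of_nonneg ?_ fun p _ _ => by positivity
    intro p hp
    obtain ⟨x, hx, rfl⟩ := Finset.mem_map.1 hp
    obtain ⟨hx1, hx2⟩ := Finset.mem_erase.1 hx
    exact Finset.mem_filter.2 ⟨Finset.mem_univ _, hx1, hx2, hu i⟩
  have h2 : ∑ p, g p ^ 2 = ((r + 1) * Fintype.card ι : ℝ) ^ 2 := by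
    rw [← sum_codeg hA, sq (∑ x, (codeg A x : ℝ)), Finset.sum_mul_sum, Fintype.sum_prod_type]
    refine Finset.sum_congr rfl fun x _ => Finset.sum_congr rfl fun y _ => ?_
    rw [hg, mul_pow, Real.sq_sqrt (Nat.cast_nonneg _), Real.sq_sqrt (Nat.cast_nonneg _)]
  have h3 : ∑ p, n p ^ 2 ≤
      (r + 1) ^ 2 * (Fintype.card ι + pairSum A c * (c : ℝ) ^ (2 * r - 1)) := by
    refine le_trans ?_ (mul_le_mul_of_nonneg_left (card_pairs_le (c := c) hr hA) (by positivity))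
    simp_rw [hn, sq (∑ i, _), Finset.sum_mul_sum]
    rw [Finset.sum_comm, Finset.mul_sum]
    refine Finset.sum_le_sum fun i _ => ?_
    rw [Finset.sum_comm, Finset.mul_sum]
    refine Finset.sum_le_sum fun j _ => ?_
    simp_rw [ite_mul_ite_eq_ite_and]
    rw [← Finset.sum_filter, Finset.sum_const, nsmul_eq_mul, mul_one]
    split_ifs with h
    · have : (Finset.univ.filter fun p : V × V => (p.1 ≠ p.2 ∧ p.1 ∈ A i ∧ p.2 ∈ A i) ∧
          p.1 ≠ p.2 ∧ p.1 ∈ A j ∧ p.2 ∈ A j).card ≤ (A i ×ˢ A i).card := by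
        refine Finset.card_le_card fun p hp => ?_
        simp only [Finset.mem_filter] at hp
        exact Finset.mem_product.2 hp.2.1.2
      rw [Finset.card_product, hA] at this
      rw [mul_one, sq]
      exact_mod_cast this
    · rw [mul_zero]
      apply le_of_eq
      rw [Nat.cast_eq_zero, Finset.card_eq_zero, Finset.filter_eq_empty_iff]
      rintro ⟨x, y⟩ - ⟨⟨hxy, hxi, hyi⟩, -, hxj, hyj⟩
      exact h (Finset.one_lt_card.2 ⟨x, by simp [hxi, hxj], y, by simp [hyi, hyj], hxy⟩)
  calc _ ≤ (∑ p, n p * g p) ^ 2 := by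
        gcongr
    _ ≤ (∑ p, n p ^ 2) * ∑ p, g p ^ 2 := Finset.sum_mul_sq_le_sq_mul_sq _ _ _
    _ ≤ _ := by
        rw [h2]
        refine (mul_le_mul_of_nonneg_right h3 (by positivity)).trans (le_of_eq ?_)
        ring

end Hypergraph

/-! ### The Stein–Chen recursion -/

section Stein

variable {V ι : Type*} [Fintype V] [Fintype ι] {r : ℕ} {A : ι → Finset V} {c : ℕ+}

lemma abs_ind_sub_ind_le (m n k : ℕ) :
    |ind (m = k + 1) - ind (n = k)| ≤ |(m : ℝ) - (n + 1)| := by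
  by_cases h : m = n + 1
  · subst h
    by_cases hk : n = k <;> simp [ind, hk]
  · have h1 : (1 : ℝ) ≤ |(m : ℝ) - (n + 1)| := by
      have : (1 : ℤ) ≤ |(m : ℤ) - (n + 1)| := Int.one_le_abs (by omega)
      exact_mod_cast this
    refine le_trans ?_ h1
    rw [abs_le]
    have := ind_nonneg (m = k + 1)
    have := ind_nonneg (n = k)
    have := ind_le_one (m = k + 1)
    have := ind_le_one (n = k)
    constructor <;> linarith

lemma mono_recolor_iff_of_disjoint {C : Type*} {X : V → C} {U B : Finset V} {u : V}
    (h : Disjoint (U.erase u) B) : Mono (recolor X U u) B ↔ Mono X B := by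
  have : ∀ x ∈ B, recolor X U u x = X x := by
    intro x hx
    unfold recolor
    split_ifs with hU
    · by_cases hxu : x = u
      · rw [hxu]
      · exact absurd hx (Finset.disjoint_left.1 h (Finset.mem_erase.2 ⟨hxu, hU⟩))
    · rfl
  exact ⟨fun hX a ha b hb => by rw [← this a ha, ← this b hb]; exact hX a ha b hb,
    fun hX a ha b hb => by rw [this a ha, this b hb]; exact hX a ha b hb⟩

lemma mono_recolor_self {C : Type*} (X : V → C) (U : Finset V) (u : V) :
    Mono (recolor X U u) U := by
  intro a ha b hb
  simp [recolor, ha, hb]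

/-- The three terms on the right pay for `j = i`, for members with two common vertices, and for
members whose single common vertex is not `u`. A member meeting `A i` only in `u` is unaffected,
since `u` keeps its color; this is why the last sum omits `u`. -/
lemma avg_abs_recolor_sub_le (hA : ∀ i, (A i).card = r + 1) {u : V} {i : ι} (hu : u ∈ A i)
    (j : ι) :
    avg (fun X : V → Fin c => |ind (Mono (recolor X (A i) u) (A j)) - ind (Mono X (A j)) -
      if j = i then 1 else 0|) ≤
      (if j = i then ((c : ℝ) ^ r)⁻¹ else 0) +
        2 * (if j ≠ i ∧ 2 ≤ (A j ∩ A i).card then wt c (A i) (A j) else 0) +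
        2 * (((c : ℝ) ^ r)⁻¹ * ∑ x ∈ (A i).erase u, if x ∈ A j then 1 else 0) := by
  have h0 := color_pos c
  have hq : 0 < ((c : ℝ) ^ r)⁻¹ := by positivity
  have hmean : ∀ j, avg (fun X : V → Fin c => ind (Mono X (A j))) = ((c : ℝ) ^ r)⁻¹ := by
    intro j
    rw [avg_ind_mono (nonempty_of_card hA j), hA, Nat.add_sub_cancel]
  have hsum : (0 : ℝ) ≤ ∑ x ∈ (A i).erase u, if x ∈ A j then 1 else 0 :=
    Finset.sum_nonneg fun x _ => by split_ifs <;> norm_num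
  by_cases hji : j = i
  · subst hji
    have : ∀ X : V → Fin c, |ind (Mono (recolor X (A j) u) (A j)) - ind (Mono X (A j)) -
        1| = ind (Mono X (A j)) := by
      intro X
      rw [ind_true (mono_recolor_self X (A j) u), abs_of_nonpos]
      · ring
      · linarith [ind_nonneg (Mono X (A j))]
    simp only [if_true, ne_eq, not_true_eq_false, false_and, if_false, this, hmean]
    have := mul_nonneg hq.le hsum
    linarith
  · simp only [hji, if_false, sub_zero, ne_eq, not_false_eq_true, true_and, zero_add]
    by_cases hd : Disjoint ((A i).erase u) (A j)
    · have : ∀ X : V → Fin c, |ind (Mono (recolor X (A i) u) (A j)) - ind (Mono X (A j))| = 0 :=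
        fun X => by rw [mono_recolor_iff_of_disjoint hd, sub_self, abs_zero]
      simp_rw [this]
      rw [avg_const]
      have hw := wt_pos (c := c) (A i) (A j)
      split_ifs <;> positivity
    · have h1 : avg (fun X : V → Fin c =>
          |ind (Mono (recolor X (A i) u) (A j)) - ind (Mono X (A j))|) ≤
          wt c (A i) (A j) + ((c : ℝ) ^ r)⁻¹ := by
        rw [← avg_ind_mono_recolor hu (nonempty_of_card hA j), ← hmean j, ← avg_add]
        refine avg_le_avg fun X => ?_
        have := ind_nonneg (Mono (recolor X (A i) u) (A j))
        have := ind_nonneg (Mono X (A j))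
        rw [abs_le]
        constructor <;> linarith
      have h2 := inv_pow_le_wt' (c := c) hA i j
      split_ifs with h
      · have := mul_nonneg hq.le hsum
        linarith
      · rw [wt_of_card_le_one hA h] at h1
        have h3 : (1 : ℝ) ≤ ∑ x ∈ (A i).erase u, if x ∈ A j then 1 else 0 := by
          obtain ⟨x, hx, hxj⟩ := Finset.not_disjoint_iff.1 hd
          refine le_trans ?_ (Finset.single_le_sum (f := fun x => if x ∈ A j then (1 : ℝ) else 0)
            (fun x _ => by split_ifs <;> norm_num) hx)
          simp [hxj]
        nlinarith

/-- Size biasing: on the event N = k + 1 the factor k + 1 is the number of monochromatic members,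
and for each of them conditioning becomes recoloring. It remains to compare the recolored count with
N + 1, member by member. -/
lemma succ_mul_countProb_sub_le (hA : ∀ i, (A i).card = r + 1) {u : ι → V}
    (hu : ∀ i, u i ∈ A i) (k : ℕ) :
    |(k + 1) * countProb A c (k + 1) - countMean A c * countProb A c k| ≤
      countMean A c * ((c : ℝ) ^ r)⁻¹ + 2 * pairSum A c +
        2 * (((c : ℝ) ^ r)⁻¹ ^ 2 * ∑ i, ∑ x ∈ (A i).erase (u i), (codeg A x : ℝ)) := by
  have h0 := color_pos c
  have h1 : (k + 1) * countProb A c (k + 1) = ∑ i, ((c : ℝ) ^ r)⁻¹ *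
      avg (fun X : V → Fin c => ind (count A (recolor X (A i) (u i)) = k + 1)) := by
    rw [countProb, ← avg_const_mul]
    have : ∀ X : V → Fin c, ((k : ℝ) + 1) * ind (count A X = k + 1) =
        ∑ i, ind (Mono X (A i)) * ind (count A X = k + 1) := by
      intro X
      rw [← Finset.sum_mul, ← count_cast]
      by_cases h : count A X = k + 1
      · rw [h]; push_cast; rfl
      · rw [ind_false h, mul_zero, mul_zero]
    simp_rw [this]
    rw [avg_sum]
    refine Finset.sum_congr rfl fun i _ => ?_
    rw [avg_ind_mono_mul (hu i), hA, Nat.add_sub_cancel]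
  have h2 : countMean A c * countProb A c k =
      ∑ _i : ι, ((c : ℝ) ^ r)⁻¹ * countProb A c k := by
    rw [countMean_eq hA]
    simp
    ring
  rw [h1, h2, ← Finset.sum_sub_distrib]
  refine (Finset.abs_sum_le_sum_abs _ _).trans ?_
  have h3 : countMean A c * ((c : ℝ) ^ r)⁻¹ + 2 * pairSum A c +
        2 * (((c : ℝ) ^ r)⁻¹ ^ 2 * ∑ i, ∑ x ∈ (A i).erase (u i), (codeg A x : ℝ)) =
      ∑ i, ((c : ℝ) ^ r)⁻¹ * ∑ j, ((if j = i then ((c : ℝ) ^ r)⁻¹ else 0) +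
        2 * (if j ≠ i ∧ 2 ≤ (A j ∩ A i).card then wt c (A i) (A j) else 0) +
        2 * (((c : ℝ) ^ r)⁻¹ * ∑ x ∈ (A i).erase (u i), if x ∈ A j then 1 else 0)) := by
    simp_rw [Finset.sum_add_distrib, mul_add, Finset.sum_add_distrib]
    congr 1
    · congr 1
      · simp [countMean_eq hA]; ring
      · rw [pairSum, Finset.mul_sum]
        refine Finset.sum_congr rfl fun i _ => ?_
        rw [Finset.mul_sum, Finset.mul_sum]
        refine Finset.sum_congr rfl fun j _ => ?_
        rw [hA, Nat.add_sub_cancel]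
        split_ifs <;> ring
    · rw [Finset.mul_sum, Finset.mul_sum]
      refine Finset.sum_congr rfl fun i _ => ?_
      rw [← Finset.mul_sum, ← Finset.mul_sum, Finset.sum_comm]
      have : ∀ x, (∑ j, if x ∈ A j then (1 : ℝ) else 0) = codeg A x := by
        intro x; simp [codeg]
      simp_rw [this]
      ring
  rw [h3]
  refine Finset.sum_le_sum fun i _ => ?_
  rw [countProb, ← mul_sub, ← avg_sub, abs_mul, abs_of_pos (by positivity)]
  refine mul_le_mul_of_nonneg_left ?_ (by positivity)
  refine le_trans ?_ (Finset.sum_le_sum fun j _ => avg_abs_recolor_sub_le (c := c) hA (hu i) j)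
  rw [← avg_sum]
  refine (abs_avg_le _).trans (avg_le_avg fun X => (abs_ind_sub_ind_le _ _ _).trans ?_)
  refine le_trans (le_of_eq ?_) (Finset.abs_sum_le_sum_abs _ _)
  congr 1
  rw [count_cast, count_cast, Finset.sum_sub_distrib, Finset.sum_sub_distrib]
  simp
  ring

/-- An approximate version of the recursion that characterizes the Poisson distribution. -/
lemma succ_mul_countProb_sub_le' (hr : 1 ≤ r) (hA : ∀ i, (A i).card = r + 1) (k : ℕ) :
    |(k + 1) * countProb A c (k + 1) - countMean A c * countProb A c k| ≤
      countMean A c * ((c : ℝ) ^ r)⁻¹ + 2 * pairSum A c + 2 * ((r + 1) ^ 2 * countMean A c *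
        √(countMean A c * ((c : ℝ) ^ r)⁻¹ + pairSum A c * (c : ℝ)⁻¹)) := by
  have h0 := color_pos c
  -- The color is taken from the vertex of largest codegree, so that the members through that vertex
  -- cost nothing and `sum_pairs_le` applies.
  have hu : ∀ i, ∃ u ∈ A i, ∀ x ∈ A i, codeg A x ≤ codeg A u := fun i =>
    Finset.exists_max_image _ _ (nonempty_of_card hA i)
  choose u hu hmax using hu
  refine (succ_mul_countProb_sub_le hA hu k).trans ?_
  refine add_le_add le_rfl (mul_le_mul_of_nonneg_left ?_ zero_le_two)
  have hμ : 0 ≤ countMean A c := avg_nonneg fun _ => Nat.cast_nonneg _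
  have hD := pairSum_nonneg (A := A) (c := c)
  refine (sq_le_sq₀ (by positivity) (by positivity)).1 ?_
  rw [mul_pow, mul_pow, Real.sq_sqrt (by positivity)]
  refine (mul_le_mul_of_nonneg_left (sum_pairs_le (c := c) hr hA hu hmax)
    (by positivity)).trans (le_of_eq ?_)
  rw [countMean_eq hA]
  obtain ⟨s, rfl⟩ : ∃ s, r = s + 1 := ⟨r - 1, by omega⟩
  have : 2 * (s + 1) - 1 = 2 * s + 1 := by omega
  rw [this]
  field_simp
  ring

end Stein

/-! ### Growth of moments -/

section Moments

variable {V ι : Type*} [Fintype V] [Fintype ι] {r : ℕ} {A : ι → Finset V} {c : ℕ+}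

/-- The m-th power is a sum over m-tuples of members. Given that a tuple with union `U` is
monochromatic, one further member is monochromatic with probability at most `wt c U (A j)`, and
these sum to at most `K`. -/
lemma avg_count_pow_succ_le (hA : ∀ i, (A i).card = r + 1) (m : ℕ) {K : ℝ}
    (hK : ∀ U : Finset V, U.card ≤ m * (r + 1) → ∑ j, wt c U (A j) ≤ K) :
    avg (fun X : V → Fin c => (count A X : ℝ) ^ (m + 1)) ≤
      K * avg (fun X : V → Fin c => (count A X : ℝ) ^ m) := by
  simp_rw [pow_succ, count_cast, Fintype.sum_pow, Finset.sum_mul_sum]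
  simp_rw [avg_sum]
  rw [Finset.mul_sum]
  refine Finset.sum_le_sum fun t _ => ?_
  set U : Finset V := Finset.univ.biUnion fun l => A (t l) with hU
  have hUcard : U.card ≤ m * (r + 1) := by
    refine Finset.card_biUnion_le.trans ?_
    simp [hA]
  have hF0 : ∀ X : V → Fin c, 0 ≤ ∏ l, ind (Mono X (A (t l))) := fun X =>
    Finset.prod_nonneg fun l _ => ind_nonneg _
  refine le_trans ?_ (mul_le_mul_of_nonneg_right (hK U hUcard) (avg_nonneg hF0))
  rw [Finset.sum_mul]
  refine Finset.sum_le_sum fun j _ => ?_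
  simp_rw [mul_comm _ (ind _)]
  refine avg_ind_mono_mul_le (nonempty_of_card hA j) ?_ hF0
  intro X Y h
  refine Finset.prod_congr rfl fun l _ => ?_
  have h' : ∀ x ∈ A (t l), X x = Y x := fun x hx =>
    h x (Finset.mem_biUnion.2 ⟨l, Finset.mem_univ _, hx⟩)
  congr 1
  exact propext ⟨fun hX a ha b hb => by rw [← h' a ha, ← h' b hb]; exact hX a ha b hb,
    fun hX a ha b hb => by rw [h' a ha, h' b hb]; exact hX a ha b hb⟩

end Moments

/-! ### Limits of sequences of probability distributions on ℕ -/

section Sequences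

lemma summable_inv_sq (B : ℝ) : Summable fun k : ℕ => (if k = 0 then 1 else B / (k : ℝ) ^ 2) := by
  have h : Summable fun k : ℕ => B / (k : ℝ) ^ 2 := by
    simp_rw [div_eq_mul_inv]
    exact (Real.summable_nat_pow_inv.2 one_lt_two).mul_left B
  refine h.congr_cofinite ?_
  filter_upwards [Set.Finite.compl_mem_cofinite (Set.finite_singleton 0)] with k hk
  have : k ≠ 0 := by simpa using hk
  simp [this]

lemma le_inv_sq {B x : ℝ} {k : ℕ} (h1 : x ≤ 1) (h2 : (k : ℝ) ^ 2 * x ≤ B) :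
    x ≤ if k = 0 then 1 else B / (k : ℝ) ^ 2 := by
  split_ifs with hk
  · exact h1
  · have : (0 : ℝ) < k := by exact_mod_cast Nat.pos_of_ne_zero hk
    rw [le_div_iff₀ (by positivity)]
    linarith

/-- The recursion determines each p_k in the limit as p_0 λ^k / k!, and total mass 1 then determines
p_0. The bound on k² p_k prevents mass from escaping to infinity. -/
lemma tendsto_poisson_of_recursion {p : ℕ → ℕ → ℝ} {μ ε : ℕ → ℝ} {l : ℝ≥0} {B : ℝ}
    (h0 : ∀ n k, 0 ≤ p n k) (h1 : ∀ n, HasSum (p n) 1)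
    (hB : ∀ᶠ n in atTop, ∀ k : ℕ, (k : ℝ) ^ 2 * p n k ≤ B)
    (hμ : Tendsto μ atTop (𝓝 (l : ℝ))) (hε : Tendsto ε atTop (𝓝 0))
    (hrec : ∀ᶠ n in atTop, ∀ k : ℕ, |(k + 1) * p n (k + 1) - μ n * p n k| ≤ ε n) (k : ℕ) :
    Tendsto (fun n => p n k) atTop (𝓝 ((poissonMeasure l).real {k})) := by
  have hle : ∀ n k, p n k ≤ 1 := fun n k => le_hasSum (h1 n) k fun j _ => h0 n j
  set a : ℕ → ℝ := fun k => (l : ℝ) ^ k / (k.factorial : ℝ) with ha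
  have hexp : HasSum a (Real.exp l) := by
    rw [Real.exp_eq_exp_ℝ]
    exact NormedSpace.expSeries_div_hasSum_exp (l : ℝ)
  have hq : ∀ k, Tendsto (fun n => p n k - p n 0 * a k) atTop (𝓝 0) := by
    intro k
    induction k with
    | zero => simp [ha]
    | succ k ih =>
      have h2 : Tendsto (fun n => (k + 1) * p n (k + 1) - μ n * p n k) atTop (𝓝 0) :=
        squeeze_zero_norm' (hrec.mono fun n hn => hn k) hε
      have h3 : Tendsto (fun n => (μ n - l) * p n k) atTop (𝓝 0) := by
        have h4 : Tendsto (fun n => |μ n - l|) atTop (𝓝 0) := by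
          simpa using (hμ.sub_const (l : ℝ)).abs
        refine squeeze_zero_norm (fun n => ?_) h4
        rw [Real.norm_eq_abs, abs_mul, abs_of_nonneg (h0 n k)]
        exact mul_le_of_le_one_right (abs_nonneg _) (hle n k)
      -- With a_k = λ^k / k!, one has (k+1)(p_{k+1} - p_0 a_{k+1}) = ((k+1) p_{k+1} - μ p_k) + (μ -
      -- λ) p_k + λ (p_k - p_0 a_k).
      have h5 := ((h2.add h3).add (ih.const_mul (l : ℝ))).const_mul ((k : ℝ) + 1)⁻¹
      simp only [mul_zero, add_zero] at h5
      refine h5.congr fun n => ?_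
      simp only [ha, Nat.factorial_succ, pow_succ]
      push_cast
      have : (k.factorial : ℝ) ≠ 0 := by exact_mod_cast k.factorial_ne_zero
      field_simp
      ring
  have hsum : Tendsto (fun n => ∑' k, (p n k - p n 0 * a k)) atTop (𝓝 (∑' _ : ℕ, (0 : ℝ))) := by
    refine tendsto_tsum_of_dominated_convergence
      (bound := fun k => (if k = 0 then 1 else B / (k : ℝ) ^ 2) + a k)
      ((summable_inv_sq B).add hexp.summable) hq ?_
    filter_upwards [hB] with n hn k
    have hak : 0 ≤ a k := by positivity
    have h3 := le_inv_sq (hle n k) (hn k)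
    have h4 := h0 n k
    have h5 : p n 0 * a k ≤ a k := mul_le_of_le_one_left hak (hle n 0)
    have h6 : 0 ≤ p n 0 * a k := mul_nonneg (h0 n 0) hak
    rw [Real.norm_eq_abs, abs_le]
    constructor <;> linarith
  have hp0 : Tendsto (fun n => p n 0) atTop (𝓝 (Real.exp (-l))) := by
    have h2 : ∀ n, ∑' k, (p n k - p n 0 * a k) = 1 - p n 0 * Real.exp l := fun n =>
      ((h1 n).sub (hexp.mul_left (p n 0))).tsum_eq
    simp_rw [h2, tsum_zero] at hsum
    have h3 := (tendsto_const_nhds (x := (1 : ℝ))).sub hsum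
    have h4 := h3.mul_const (Real.exp (-l))
    simp only [sub_zero, one_mul] at h4
    refine h4.congr fun n => ?_
    rw [sub_sub_cancel, mul_assoc, ← Real.exp_add, add_neg_cancel, Real.exp_zero, mul_one]
  have h2 := (hq k).add (hp0.mul_const (a k))
  rw [zero_add] at h2
  rw [poissonMeasure_real_singleton]
  have h3 : Real.exp (-l) * (l : ℝ) ^ k / (k.factorial : ℝ) = Real.exp (-l) * a k := by
    simp only [ha]; ring
  rw [h3]
  exact h2.congr fun n => by ring

lemma tendsto_tsum_pow_mul {p : ℕ → ℕ → ℝ} {q : ℕ → ℝ} (m : ℕ) {B B' : ℝ}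
    (h0 : ∀ n k, 0 ≤ p n k)
    (hB : ∀ᶠ n in atTop, ∀ k : ℕ, (k : ℝ) ^ (m + 2) * p n k ≤ B)
    (hB' : ∀ᶠ n in atTop, ∀ k : ℕ, p n k ≤ B')
    (hp : ∀ k, Tendsto (fun n => p n k) atTop (𝓝 (q k))) :
    Tendsto (fun n => ∑' k : ℕ, (k : ℝ) ^ m * p n k) atTop (𝓝 (∑' k : ℕ, (k : ℝ) ^ m * q k)) ∧
      Summable fun k : ℕ => (k : ℝ) ^ m * q k := by
  -- The bound through `B` says nothing at k = 0, where `B'` dominates instead (for m = 0 that term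
  -- is p_0, as 0 ^ 0 = 1).
  have hs : Summable fun k : ℕ => B' * (if k = 0 then 1 else 0) +
      (if k = 0 then 1 else B / (k : ℝ) ^ 2) := by
    refine Summable.add ?_ (summable_inv_sq B)
    exact summable_of_hasFiniteSupport ((Set.finite_singleton 0).subset fun k hk => by
      by_contra h
      have : k ≠ 0 := by simpa using h
      simp [this] at hk)
  have hbd : ∀ᶠ n in atTop, ∀ k : ℕ, ‖(k : ℝ) ^ m * p n k‖ ≤
      B' * (if k = 0 then 1 else 0) + (if k = 0 then 1 else B / (k : ℝ) ^ 2) := by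
    filter_upwards [hB, hB'] with n hn hn' k
    rw [Real.norm_of_nonneg (mul_nonneg (by positivity) (h0 n k))]
    by_cases hk : k = 0
    · subst hk
      have h1 : ((0 : ℕ) : ℝ) ^ m ≤ 1 := pow_le_one₀ (by simp) (by simp)
      have h2 := mul_le_of_le_one_left (h0 n 0) h1
      have h3 := hn' 0
      simp only [if_true]
      linarith
    · have : (0 : ℝ) < k := by exact_mod_cast Nat.pos_of_ne_zero hk
      simp only [hk, if_false, mul_zero, zero_add]
      rw [le_div_iff₀ (by positivity)]
      have h1 := hn k
      rw [pow_add] at h1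
      linarith
  have hlim : ∀ k : ℕ, Tendsto (fun n => (k : ℝ) ^ m * p n k) atTop (𝓝 ((k : ℝ) ^ m * q k)) :=
    fun k => (hp k).const_mul _
  refine ⟨tendsto_tsum_of_dominated_convergence hs hlim hbd, ?_⟩
  refine Summable.of_norm_bounded hs fun k => ?_
  exact le_of_tendsto (hlim k).norm (hbd.mono fun n hn => hn k)

lemma hasSum_mean_poisson (l : ℝ≥0) :
    HasSum (fun k : ℕ => (k : ℝ) * (poissonMeasure l).real {k}) l := by
  rw [← hasSum_nat_add_iff' 1]
  simp only [Finset.range_one, Finset.sum_singleton, Nat.cast_zero, zero_mul, sub_zero]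
  have h := (hasSum_one_poissonMeasure l).mul_left (l : ℝ)
  rw [mul_one] at h
  refine h.congr_fun fun k => ?_
  rw [poissonMeasure_real_singleton, Nat.factorial_succ, pow_succ]
  push_cast
  field_simp

lemma hasSum_sq_poisson (l : ℝ≥0) :
    HasSum (fun k : ℕ => (k : ℝ) ^ 2 * (poissonMeasure l).real {k}) (l + l ^ 2) := by
  rw [← hasSum_nat_add_iff' 1]
  simp only [Finset.range_one, Finset.sum_singleton, Nat.cast_zero, ne_eq, OfNat.ofNat_ne_zero,
    not_false_eq_true, zero_pow, zero_mul, sub_zero]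
  have h := ((hasSum_mean_poisson l).add (hasSum_one_poissonMeasure l)).mul_left (l : ℝ)
  have h2 : (l : ℝ) * (l + 1) = l + (l : ℝ) ^ 2 := by ring
  rw [h2] at h
  refine h.congr_fun fun k => ?_
  rw [poissonMeasure_real_singleton, poissonMeasure_real_singleton, Nat.factorial_succ, pow_succ]
  push_cast
  field_simp
  ring

/-- Scheffé's lemma for sequences. -/
lemma tendsto_tsum_abs_sub {p : ℕ → ℕ → ℝ} {q : ℕ → ℝ} (h0 : ∀ n k, 0 ≤ p n k)
    (h1 : ∀ n, HasSum (p n) 1) (hq : HasSum q 1)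
    (hp : ∀ k, Tendsto (fun n => p n k) atTop (𝓝 (q k))) :
    Tendsto (fun n => ∑' k, |p n k - q k|) atTop (𝓝 0) := by
  have hq0 : ∀ k, 0 ≤ q k := fun k => ge_of_tendsto' (hp k) fun n => h0 n k
  have hmin : Tendsto (fun n => ∑' k, min (p n k) (q k)) atTop (𝓝 (∑' k, q k)) := by
    refine tendsto_tsum_of_dominated_convergence (bound := q) hq.summable (fun k => ?_)
      (Eventually.of_forall fun n k => ?_)
    · simpa using (hp k).min (tendsto_const_nhds (x := q k))
    · rw [Real.norm_of_nonneg (le_min (h0 n k) (hq0 k))]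
      exact min_le_right _ _
  have hsm : ∀ n, Summable fun k => min (p n k) (q k) := fun n =>
    Summable.of_nonneg_of_le (fun k => le_min (h0 n k) (hq0 k)) (fun k => min_le_right _ _)
      hq.summable
  -- Since |p - q| = p + q - 2 min(p, q), it suffices to pass to the limit in the minimum, which `q`
  -- dominates.
  have : ∀ n, ∑' k, |p n k - q k| = 2 - 2 * ∑' k, min (p n k) (q k) := by
    intro n
    have h2 := ((h1 n).add hq).sub ((hsm n).hasSum.mul_left 2)
    rw [show (1 : ℝ) + 1 - 2 * ∑' k, min (p n k) (q k) = 2 - 2 * ∑' k, min (p n k) (q k) by ring]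
      at h2
    rw [← h2.tsum_eq]
    refine tsum_congr fun k => ?_
    rcases le_total (p n k) (q k) with h | h
    · rw [min_eq_left h, abs_of_nonpos (by linarith)]; ring
    · rw [min_eq_right h, abs_of_nonneg (by linarith)]; ring
  simp_rw [this]
  have h3 := (hmin.const_mul 2).const_sub 2
  rwa [hq.tsum_eq, mul_one, sub_self] at h3

end Sequences

/-! ### Weak convergence and point probabilities -/

section Distribution

lemma hasSum_avg_comp {V : Type*} [Fintype V] {c : ℕ+} (f : (V → Fin c) → ℕ) (g : ℕ → ℝ) :
    HasSum (fun k => g k * avg fun X => ind (f X = k)) (avg fun X => g (f X)) := by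
  simp_rw [avg, ← mul_div_assoc, Finset.mul_sum]
  refine HasSum.div_const (hasSum_sum fun X _ => ?_) _
  have : (fun k => g k * ind (f X = k)) = fun k => if k = f X then g (f X) else 0 := by
    funext k
    by_cases h : k = f X
    · simp [h, ind]
    · simp [h, ind, Ne.symm h]
  rw [this]
  exact hasSum_ite_eq (f X) (g (f X))

lemma avg_ind_le_one {V : Type*} [Fintype V] {c : ℕ+} (P : (V → Fin c) → Prop) :
    avg (fun X => ind (P X)) ≤ 1 :=
  (avg_le_avg fun _ => ind_le_one _).trans_eq (avg_const 1)

lemma hasSum_avg_ind {V : Type*} [Fintype V] {c : ℕ+} (f : (V → Fin c) → ℕ) :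
    HasSum (fun k => avg fun X => ind (f X = k)) 1 := by
  simpa [avg_const] using hasSum_avg_comp f fun _ => 1

/-- Convergence in distribution of integer-valued statistics of colorings is convergence of the
point probabilities. -/
lemma tendstoInDistribution_iff {V : ℕ → Type*} [∀ n, Fintype (V n)] {c : ℕ → ℕ+}
    (f : ∀ n, (V n → Fin (c n)) → ℕ) (l : ℝ≥0) :
    TendstoInDistribution (fun n (X : V n → Fin (c n)) => (f n X : ℝ)) atTop
      (fun k : ℕ => (k : ℝ)) (fun n => coloring (V n) (c n)) (poissonMeasure l) ↔
    ∀ k, Tendsto (fun n => avg fun X => ind (f n X = k)) atTop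
      (𝓝 ((poissonMeasure l).real {k})) := by
  have hmeas : ∀ n, AEMeasurable (fun X : V n → Fin (c n) => (f n X : ℝ))
      (coloring (V n) (c n)) := fun n => (measurable_of_countable _).aemeasurable
  have hmeas' : AEMeasurable (fun k : ℕ => (k : ℝ)) (poissonMeasure l) := by fun_prop
  have hint : ∀ φ : BoundedContinuousFunction ℝ ℝ, Integrable (fun k : ℕ => φ k)
      (poissonMeasure l) := fun φ =>
    Integrable.of_bound (measurable_of_countable _).aestronglyMeasurable ‖φ‖
      (Eventually.of_forall fun k => φ.norm_coe_le_norm _)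
  have hlim : ∀ φ : BoundedContinuousFunction ℝ ℝ,
      ∫ x, φ x ∂((poissonMeasure l).map fun k : ℕ => (k : ℝ)) =
        ∑' k : ℕ, φ k * (poissonMeasure l).real {k} := by
    intro φ
    rw [integral_map hmeas' φ.continuous.aestronglyMeasurable, integral_countable (hint φ)]
    simp [mul_comm]
  have hn : ∀ (φ : BoundedContinuousFunction ℝ ℝ) n,
      ∫ x, φ x ∂((coloring (V n) (c n)).map fun X => (f n X : ℝ)) = avg fun X => φ (f n X) := by
    intro φ n
    rw [integral_map (hmeas n) φ.continuous.aestronglyMeasurable, integral_coloring]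
  have hq : HasSum (fun k => (poissonMeasure l).real {k}) 1 := by
    simp_rw [poissonMeasure_real_singleton]
    exact hasSum_one_poissonMeasure l
  constructor
  · intro H k
    have h := ProbabilityMeasure.tendsto_iff_forall_integral_tendsto.1 H.tendsto
    -- A tent of half-width 1 around k agrees on the integers with the indicator of k.
    let φ : BoundedContinuousFunction ℝ ℝ := BoundedContinuousFunction.ofNormedAddCommGroup
      (fun x => max 0 (1 - |x - k|)) (by fun_prop) 1 (fun x => by
        rw [Real.norm_of_nonneg (le_max_left _ _)]
        exact max_le zero_le_one (by linarith [abs_nonneg (x - k)]))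
    have hφ : ∀ j : ℕ, φ j = ind (j = k) := by
      intro j
      change max 0 (1 - |(j : ℝ) - k|) = _
      by_cases hjk : j = k
      · simp [hjk, ind]
      · rw [ind_false hjk, max_eq_left]
        have : (1 : ℤ) ≤ |(j : ℤ) - k| := Int.one_le_abs (by omega)
        have : (1 : ℝ) ≤ |(j : ℝ) - k| := by exact_mod_cast this
        linarith
    have h1 := h φ
    simp only [ProbabilityMeasure.coe_mk] at h1
    rw [hlim] at h1
    simp_rw [hn, hφ] at h1
    rw [tsum_eq_single k (fun j hj => by rw [ind_false hj, zero_mul]), ind_true rfl, one_mul] at h1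
    exact h1
  · intro h
    refine ⟨hmeas, hmeas', ?_⟩
    refine ProbabilityMeasure.tendsto_iff_forall_integral_tendsto.2 fun φ => ?_
    simp only [ProbabilityMeasure.coe_mk]
    rw [hlim]
    simp_rw [hn]
    have h1 := tendsto_tsum_abs_sub (fun n k => avg_nonneg fun X => ind_nonneg _)
      (fun n => hasSum_avg_ind (f n)) hq h
    rw [tendsto_iff_norm_sub_tendsto_zero]
    have h2 := h1.const_mul ‖φ‖
    rw [mul_zero] at h2
    refine squeeze_zero (fun n => norm_nonneg _) (fun n => ?_) h2
    have hs : Summable fun k : ℕ => φ k * (poissonMeasure l).real {k} :=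
      Summable.of_norm_bounded (hq.summable.mul_left ‖φ‖) fun k => by
        rw [norm_mul, Real.norm_of_nonneg measureReal_nonneg]
        exact mul_le_mul_of_nonneg_right (φ.norm_coe_le_norm _) measureReal_nonneg
    have hs2 : Summable fun k : ℕ =>
        |avg (fun X => ind (f n X = k)) - (poissonMeasure l).real {k}| :=
      ((hasSum_avg_ind (f n)).summable.sub hq.summable).abs
    rw [← (hasSum_avg_comp (f n) fun k => φ k).tsum_eq,
      ← Summable.tsum_sub (hasSum_avg_comp (f n) fun k => φ k).summable hs, ← tsum_mul_left]
    refine tsum_of_norm_bounded (hs2.mul_left ‖φ‖).hasSum fun k => ?_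
    rw [← mul_sub, norm_mul, Real.norm_eq_abs (_ - _)]
    exact mul_le_mul_of_nonneg_right (φ.norm_coe_le_norm _) (abs_nonneg _)

end Distribution

/-! ### Poisson limit for uniform families with vanishing pair sum -/

section PoissonLimit

lemma countMean_nonneg {V ι : Type*} [Fintype V] [Fintype ι] (A : ι → Finset V) (c : ℕ+) :
    0 ≤ countMean A c :=
  avg_nonneg fun _ => Nat.cast_nonneg _

lemma variance_le_countMean_add {V ι : Type*} [Fintype V] [Fintype ι] {r : ℕ} {A : ι → Finset V}
    {c : ℕ+} (hA : ∀ i, (A i).card = r + 1) :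
    avg (fun X : V → Fin c => (count A X : ℝ) ^ 2) - countMean A c ^ 2 ≤
      countMean A c + pairSum A c := by
  have h0 := color_pos c
  refine (variance_le_sum hA).trans ?_
  have : countMean A c = ∑ i : ι, ∑ j : ι, if j = i then ((c : ℝ) ^ r)⁻¹ else 0 := by
    rw [countMean_eq hA]; simp
  rw [this, pairSum, ← Finset.sum_add_distrib]
  refine Finset.sum_le_sum fun i _ => ?_
  rw [← Finset.sum_add_distrib]
  refine Finset.sum_le_sum fun j _ => ?_
  have hw := wt_pos (c := c) (A i) (A j)
  by_cases hij : j = i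
  · subst hij
    have : (0 : ℝ) < ((c : ℝ) ^ r)⁻¹ := by positivity
    simp only [wt_self hA, mul_one, if_true, ne_eq, not_true_eq_false, false_and, if_false,
      add_zero]
    split_ifs
    · exact le_rfl
    · exact this.le
  · simp [hij, hA]

lemma countProb_nonneg {V ι : Type*} [Fintype V] [Fintype ι] (A : ι → Finset V) (c : ℕ+) (k : ℕ) :
    0 ≤ countProb A c k :=
  avg_nonneg fun _ => ind_nonneg _

lemma hasSum_countProb {V ι : Type*} [Fintype V] [Fintype ι] (A : ι → Finset V) (c : ℕ+) :
    HasSum (countProb A c) 1 :=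
  hasSum_avg_ind fun X : V → Fin c => count A X

lemma pow_mul_countProb_le {V ι : Type*} [Fintype V] [Fintype ι] (A : ι → Finset V) (c : ℕ+)
    (m k : ℕ) :
    (k : ℝ) ^ m * countProb A c k ≤ avg (fun X : V → Fin c => (count A X : ℝ) ^ m) :=
  le_hasSum (hasSum_avg_comp (fun X : V → Fin c => count A X) fun k => (k : ℝ) ^ m) k
    fun j _ => mul_nonneg (by positivity) (avg_nonneg fun _ => ind_nonneg _)

variable {V ι : ℕ → Type*} [∀ n, Fintype (V n)] [∀ n, Fintype (ι n)] {r : ℕ}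
  {A : ∀ n, ι n → Finset (V n)} {c : ℕ → ℕ+} {l : ℝ≥0}

lemma tendsto_color (hc : Tendsto c atTop atTop) :
    Tendsto (fun n => ((c n : ℕ) : ℝ)) atTop atTop := by
  refine tendsto_natCast_atTop_atTop.comp ?_
  rw [tendsto_atTop] at hc ⊢
  intro b
  filter_upwards [hc b.succPNat] with n hn
  have : (b.succPNat : ℕ) ≤ c n := hn
  rw [Nat.succPNat_coe] at this
  omega

lemma tendsto_inv_color_pow (hc : Tendsto c atTop atTop) (hr : 1 ≤ r) :
    Tendsto (fun n => (((c n : ℕ) : ℝ) ^ r)⁻¹) atTop (𝓝 0) :=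
  ((tendsto_pow_atTop (by omega)).comp (tendsto_color hc)).inv_tendsto_atTop

lemma tendsto_countProb (hr : 1 ≤ r) (hA : ∀ n i, (A n i).card = r + 1)
    (hc : Tendsto c atTop atTop)
    (hμ : Tendsto (fun n => countMean (A n) (c n)) atTop (𝓝 (l : ℝ)))
    (hD : Tendsto (fun n => pairSum (A n) (c n)) atTop (𝓝 0)) (k : ℕ) :
    Tendsto (fun n => countProb (A n) (c n) k) atTop (𝓝 ((poissonMeasure l).real {k})) := by
  have hq := tendsto_inv_color_pow hc hr
  have hq1 : Tendsto (fun n => ((c n : ℕ) : ℝ)⁻¹) atTop (𝓝 0) :=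
    (tendsto_color hc).inv_tendsto_atTop
  have hbd : Tendsto (fun n => countMean (A n) (c n) + pairSum (A n) (c n) +
      countMean (A n) (c n) ^ 2) atTop (𝓝 (l + 0 + (l : ℝ) ^ 2)) := (hμ.add hD).add (hμ.pow 2)
  have hε : Tendsto (fun n => countMean (A n) (c n) * (((c n : ℕ) : ℝ) ^ r)⁻¹ +
      2 * pairSum (A n) (c n) + 2 * (((r : ℝ) + 1) ^ 2 * countMean (A n) (c n) *
        √(countMean (A n) (c n) * (((c n : ℕ) : ℝ) ^ r)⁻¹ +
          pairSum (A n) (c n) * ((c n : ℕ) : ℝ)⁻¹))) atTop (𝓝 0) := by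
    have h1 := (((hμ.mul hq).add (hD.const_mul 2))).add (((hμ.const_mul (((r : ℝ) + 1) ^ 2)).mul
      ((hμ.mul hq).add (hD.mul hq1)).sqrt).const_mul 2)
    rw [show (0 : ℝ) = l * 0 + 2 * 0 + 2 * (((r : ℝ) + 1) ^ 2 * l * √(l * 0 + 0 * 0)) by simp]
    exact h1
  have hB : ∀ᶠ n in atTop, ∀ k : ℕ, (k : ℝ) ^ 2 * countProb (A n) (c n) k ≤
      l + 0 + (l : ℝ) ^ 2 + 1 := by
    filter_upwards [hbd.eventually (eventually_le_nhds (lt_add_one _))] with n hn k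
    have h1 := pow_mul_countProb_le (A n) (c n) 2 k
    have h2 := variance_le_countMean_add (c := c n) (hA n)
    linarith
  exact tendsto_poisson_of_recursion (p := fun n k => countProb (A n) (c n) k)
    (fun n k => countProb_nonneg _ _ _) (fun n => hasSum_countProb _ _) hB hμ hε
    (Eventually.of_forall fun n k => succ_mul_countProb_sub_le' hr (hA n) k) k

end PoissonLimit

/-! ### Labelled and unlabelled copies of a graph -/

section Copies

variable {W V : Type*} [Fintype W] [Fintype V]

/-- Two copies of `H` in `G` are equivalent if they differ by an automorphism of `H`. -/
def copySetoid (H : SimpleGraph W) (G : SimpleGraph V) : Setoid (H.Copy G) where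
  r f g := ∃ φ : H ≃g H, ∀ x, g x = f (φ x)
  iseqv :=
    ⟨fun _ => ⟨RelIso.refl _, fun _ => rfl⟩,
      fun {_ _} ⟨φ, h⟩ => ⟨φ.symm, fun x => by rw [h, RelIso.apply_symm_apply]⟩,
      fun {_ _ _} ⟨φ, h⟩ ⟨ψ, h'⟩ => ⟨ψ.trans φ, fun x => by rw [h', h]; rfl⟩⟩

/-- The unlabelled copies of `H` in `G`. -/
def CopyClass (H : SimpleGraph W) (G : SimpleGraph V) : Type _ := Quotient (copySetoid H G)

instance (H : SimpleGraph W) (G : SimpleGraph V) : Fintype (H.Copy G) :=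
  @Fintype.ofFinite _ (DFunLike.finite _)

instance (H : SimpleGraph W) (G : SimpleGraph V) : Fintype (CopyClass H G) :=
  inferInstanceAs (Fintype (Quotient (copySetoid H G)))

/-- The vertex set of a labelled copy of `H`. -/
def copyImage {H : SimpleGraph W} {G : SimpleGraph V} (f : H.Copy G) : Finset V :=
  Finset.univ.map f.toEmbedding

/-- The vertex set of an unlabelled copy of `H`. -/
def copySet (H : SimpleGraph W) (G : SimpleGraph V) (q : CopyClass H G) : Finset V :=
  copyImage (Quotient.out q)

variable {H : SimpleGraph W} {G : SimpleGraph V}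

lemma mem_copyImage {f : H.Copy G} {v : V} : v ∈ copyImage f ↔ ∃ x, f x = v := by
  simp only [copyImage, Finset.mem_map, Finset.mem_univ, true_and]
  rfl

lemma card_copyImage (f : H.Copy G) : (copyImage f).card = Fintype.card W := by
  simp [copyImage]

lemma card_copySet (q : CopyClass H G) : (copySet H G q).card = Fintype.card W :=
  card_copyImage _

lemma copyImage_eq_of_equiv {f g : H.Copy G} (h : (copySetoid H G).r f g) :
    copyImage f = copyImage g := by
  obtain ⟨φ, h⟩ := h
  ext v
  rw [mem_copyImage, mem_copyImage]
  exact ⟨fun ⟨x, hx⟩ => ⟨φ.symm x, by rw [h, RelIso.apply_symm_apply, hx]⟩,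
    fun ⟨x, hx⟩ => ⟨φ x, by rw [← h, hx]⟩⟩

lemma finite_iso (H : SimpleGraph W) : Finite (H ≃g H) := DFunLike.finite _

lemma card_iso_pos (H : SimpleGraph W) : 0 < Nat.card (H ≃g H) := by
  have := finite_iso H
  have : Nonempty (H ≃g H) := ⟨RelIso.refl _⟩
  exact Nat.card_pos

/-- Automorphisms of `H` act on labelled copies by precomposition. The action is free because copies
are injective, so every class has exactly |Aut H| elements, all with the same vertex set. -/
lemma sum_copy_eq (F : Finset V → ℝ) :
    ∑ f : H.Copy G, F (copyImage f) = Nat.card (H ≃g H) * ∑ q, F (copySet H G q) := by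
  have := finite_iso H
  have := Fintype.ofFinite (H ≃g H)
  let π : H.Copy G → CopyClass H G := fun f => Quotient.mk (copySetoid H G) f
  rw [← Finset.sum_fiberwise (s := Finset.univ) (g := π), Finset.mul_sum]
  refine Finset.sum_congr rfl fun q _ => ?_
  have h1 : ∀ f ∈ Finset.univ.filter (fun f => π f = q), F (copyImage f) = F (copySet H G q) := by
    intro f hf
    rw [Finset.mem_filter] at hf
    have : π f = π (Quotient.out q) := hf.2.trans (Quotient.out_eq q).symm
    rw [copySet, copyImage_eq_of_equiv (Quotient.exact this)]
  rw [Finset.sum_congr rfl h1, Finset.sum_const, nsmul_eq_mul]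
  congr 2
  rw [Nat.card_eq_fintype_card, ← Finset.card_univ]
  symm
  let f₀ : H.Copy G := Quotient.out q
  refine Finset.card_bij (fun φ _ => f₀.comp φ.toCopy) ?_ ?_ ?_
  · intro φ _
    refine Finset.mem_filter.2 ⟨Finset.mem_univ _, ?_⟩
    rw [← Quotient.out_eq q]
    exact (Quotient.sound (s := copySetoid H G) ⟨φ, fun x => rfl⟩ :
      Quotient.mk _ f₀ = Quotient.mk _ (f₀.comp φ.toCopy)).symm
  · intro φ _ ψ _ h
    refine RelIso.ext fun x => f₀.injective ?_
    exact DFunLike.congr_fun h x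
  · intro f hf
    rw [Finset.mem_filter] at hf
    have : Quotient.mk (copySetoid H G) f₀ = Quotient.mk _ f :=
      (Quotient.out_eq q).trans hf.2.symm
    obtain ⟨φ, hφ⟩ := Quotient.exact this
    exact ⟨φ, Finset.mem_univ _, DFunLike.ext _ _ fun x => (hφ x).symm⟩

lemma mono_copyImage {C : Type*} {X : V → C} {f : H.Copy G} :
    Mono X (copyImage f) ↔ ∀ a b, X (f a) = X (f b) := by
  constructor
  · exact fun h a b => h _ (mem_copyImage.2 ⟨a, rfl⟩) _ (mem_copyImage.2 ⟨b, rfl⟩)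
  · intro h a ha b hb
    obtain ⟨x, rfl⟩ := mem_copyImage.1 ha
    obtain ⟨y, rfl⟩ := mem_copyImage.1 hb
    exact h x y

lemma T_eq_sum_copy {c : ℕ+} (X : V → Fin c) :
    T H G X = (1 / (Nat.card (H ≃g H) : ℝ)) * ∑ f : H.Copy G, ind (Mono X (copyImage f)) := by
  rw [T]
  congr 1
  symm
  have hprod : ∀ s : W ↪ V, (∏ e ∈ H.edgeFinset, if e.map s ∈ G.edgeSet then (1 : ℝ) else 0) =
      ind (∀ a b, H.Adj a b → G.Adj (s a) (s b)) := by
    intro s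
    by_cases h : ∀ a b, H.Adj a b → G.Adj (s a) (s b)
    · rw [ind_true h]
      refine Finset.prod_eq_one fun e he => if_pos ?_
      induction e with
      | _ a b =>
        rw [SimpleGraph.mem_edgeFinset, SimpleGraph.mem_edgeSet] at he
        rw [Sym2.map_mk, SimpleGraph.mem_edgeSet]
        exact h a b he
    · rw [ind_false h]
      push Not at h
      obtain ⟨a, b, hab, hG⟩ := h
      refine Finset.prod_eq_zero (i := s(a, b)) ?_ ?_
      · rw [SimpleGraph.mem_edgeFinset, SimpleGraph.mem_edgeSet]
        exact hab
      · exact if_neg (by rwa [Sym2.map_mk, SimpleGraph.mem_edgeSet])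
  refine Fintype.sum_of_injective (fun f : H.Copy G => f.toEmbedding) ?_ _ _ ?_ ?_
  · intro f g h
    exact DFunLike.ext _ _ fun x => DFunLike.congr_fun h x
  · intro s hs
    rw [hprod, ind_false, zero_mul]
    intro h
    exact hs ⟨⟨⟨s, fun {a b} hab => h a b hab⟩, s.injective⟩, rfl⟩
  · intro f
    have h : ∀ a b, H.Adj a b → G.Adj (f.toEmbedding a) (f.toEmbedding b) :=
      fun a b hab => f.toHom.map_adj hab
    rw [hprod, ind_true h, one_mul, mono_copyImage]
    by_cases h' : ∀ a b, X (f.toEmbedding a) = X (f.toEmbedding b)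
    · rw [if_pos h']; exact ind_true h'
    · rw [if_neg h']; exact ind_false h'

/-- The statistic `T(H, G)` counts the monochromatic unlabelled copies of `H`. -/
lemma T_eq_count {c : ℕ+} (X : V → Fin c) : T H G X = count (copySet H G) X := by
  rw [T_eq_sum_copy, sum_copy_eq fun B => ind (Mono X B), count_cast, ← mul_assoc, one_div,
    inv_mul_cancel₀ (by exact_mod_cast (card_iso_pos H).ne'), one_mul]

lemma mean_eq (c : ℕ+) : mean H G c = countMean (copySet H G) c := by
  rw [mean, integral_coloring]
  exact congrArg avg (funext T_eq_count)

lemma moment_eq (c : ℕ+) (m : ℕ) :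
    moment H G c m = avg fun X : V → Fin c => (count (copySet H G) X : ℝ) ^ m := by
  rw [moment, integral_coloring]
  exact congrArg avg (funext fun X => by rw [T_eq_count])

lemma var_eq (c : ℕ+) :
    var H G c = avg (fun X : V → Fin c => (count (copySet H G) X : ℝ) ^ 2) -
      countMean (copySet H G) c ^ 2 := by
  rw [var, variance_eq_sub MemLp.of_discrete, ← mean_eq]
  congr 1
  simp only [Pi.pow_apply]
  exact moment_eq c 2

lemma convergesToPoisson_iff {V : ℕ → Type*} [∀ n, Fintype (V n)] {G : ∀ n, SimpleGraph (V n)}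
    {c : ℕ → ℕ+} {l : ℝ≥0} :
    ConvergesToPoisson H G c l ↔ ∀ k, Tendsto (fun n => countProb (copySet H (G n)) (c n) k) atTop
      (𝓝 ((poissonMeasure l).real {k})) := by
  rw [ConvergesToPoisson]
  simp_rw [T_eq_count]
  exact tendstoInDistribution_iff (fun n X => count (copySet H (G n)) X) l

end Copies

/-! ### Counting stars through the maximum degree -/

section Star

variable {V : Type*} [Fintype V] {G : SimpleGraph V} {r : ℕ}

lemma exists_neighbor_index {Δ : ℕ} (hΔ : ∀ v, G.degree v ≤ Δ) :
    ∃ idx : V → V → ℕ, ∀ v, (∀ w, G.Adj v w → idx v w < Δ) ∧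
      ∀ w w', G.Adj v w → G.Adj v w' → idx v w = idx v w' → w = w' := by
  have : ∀ v, ∃ f : V → ℕ, (∀ w, G.Adj v w → f w < Δ) ∧
      ∀ w w', G.Adj v w → G.Adj v w' → f w = f w' → w = w' := by
    intro v
    refine ⟨fun w => if h : w ∈ G.neighborFinset v then
      ((G.neighborFinset v).equivFin ⟨w, h⟩ : ℕ) else 0, ?_, ?_⟩
    · intro w hw
      beta_reduce
      rw [dif_pos (by simpa using hw)]
      exact (Fin.is_lt _).trans_le (hΔ v)
    · intro w w' hw hw' h
      beta_reduce at h
      rw [dif_pos (by simpa using hw), dif_pos (by simpa using hw')] at h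
      have := (G.neighborFinset v).equivFin.injective (Fin.ext h)
      exact congrArg Subtype.val this
  choose idx h using this
  exact ⟨idx, h⟩

/-- The number of copies of a star that meet `U` in a prescribed nonempty set of their vertices. -/
lemma card_star_copies_le {Δ : ℕ} (hΔ : ∀ v, G.degree v ≤ Δ) (U : Finset V)
    {P : Finset (Fin 1 ⊕ Fin r)} (hP : P.Nonempty) :
    (Finset.univ.filter fun f : (star r).Copy G =>
      (Finset.univ.filter fun x => f x ∈ U) = P).card ≤ U.card ^ P.card * Δ ^ (r + 1 - P.card) := by
  obtain ⟨idx, hidx⟩ := exists_neighbor_index hΔ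
  obtain ⟨p, hp⟩ := hP
  let e : V ↪ ℕ := (Fintype.equivFin V).toEmbedding.trans Fin.valEmbedding
  -- The star is traversed from a vertex `p` placed in `U`: the center hangs from `p`, the leaves
  -- from the center. A vertex outside `P` is encoded by its number among the neighbors of its
  -- parent's image, so a copy is recovered from `p`, then the center, then the leaves.
  let par : Fin 1 ⊕ Fin r → Fin 1 ⊕ Fin r := Sum.elim (fun _ => p) fun _ => Sum.inl 0
  have hpar : ∀ x ∉ P, (star r).Adj (par x) x := by
    rintro (x | x) hx
    · rcases p with p | p
      · rw [Subsingleton.elim x p] at hx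
        exact absurd hp hx
      · simp [par]
    · simp [par]
  let code : (star r).Copy G → (Fin 1 ⊕ Fin r → ℕ) := fun f x =>
    if x ∈ P then e (f x) else idx (f (par x)) (f x)
  have hcard : (Fintype.piFinset fun x : Fin 1 ⊕ Fin r =>
      if x ∈ P then U.map e else Finset.range Δ).card = U.card ^ P.card * Δ ^ (r + 1 - P.card) := by
    rw [Fintype.card_piFinset]
    simp_rw [apply_ite Finset.card, Finset.card_map, Finset.card_range]
    rw [Finset.prod_ite, Finset.prod_const, Finset.prod_const, Finset.filter_mem_eq_inter,
      Finset.univ_inter, Finset.filter_not, Finset.filter_mem_eq_inter, Finset.univ_inter,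
      ← Finset.compl_eq_univ_sdiff, Finset.card_compl]
    congr 2
    simp [add_comm]
  rw [← hcard]
  refine Finset.card_le_card_of_injOn code ?_ ?_
  · intro f hf
    have hf' := (Finset.mem_filter.1 hf).2
    refine Fintype.mem_piFinset.2 fun x => ?_
    by_cases hx : x ∈ P
    · have hfx : f x ∈ U := by
        rw [← hf'] at hx
        exact (Finset.mem_filter.1 hx).2
      simpa [code, hx] using hfx
    · simp only [code, hx, if_false, Finset.mem_range]
      exact (hidx _).1 _ (f.toHom.map_adj (hpar x hx))
  · intro f _ g _ hfg
    have hmem : ∀ x ∈ P, f x = g x := by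
      intro x hx
      have := congrFun hfg x
      simpa [code, hx] using this
    have hstep : ∀ x, f (par x) = g (par x) → f x = g x := by
      intro x h
      by_cases hx : x ∈ P
      · exact hmem x hx
      · have h1 := congrFun hfg x
        simp only [code, hx, if_false] at h1
        rw [← h] at h1
        refine (hidx _).2 _ _ (f.toHom.map_adj (hpar x hx)) ?_ h1
        have := g.toHom.map_adj (hpar x hx)
        rw [SimpleGraph.Copy.toHom_apply, SimpleGraph.Copy.toHom_apply, ← h] at this
        exact this
    have hroot : ∀ a, f (Sum.inl a) = g (Sum.inl a) := fun a => hstep _ (hmem p hp)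
    refine DFunLike.ext _ _ ?_
    rintro (x | x)
    · exact hroot x
    · exact hstep _ (hroot 0)

lemma card_copyImage_inter {W : Type*} [Fintype W] {H : SimpleGraph W} (f : H.Copy G)
    (U : Finset V) : (copyImage f ∩ U).card = (Finset.univ.filter fun x => f x ∈ U).card := by
  rw [← Finset.card_map f.toEmbedding]
  congr 1
  ext v
  simp only [Finset.mem_inter, mem_copyImage, Finset.mem_map, Finset.mem_filter, Finset.mem_univ,
    true_and]
  constructor
  · rintro ⟨⟨x, rfl⟩, hv⟩
    exact ⟨x, hv, rfl⟩
  · rintro ⟨x, hx, rfl⟩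
    exact ⟨⟨x, rfl⟩, hx⟩

/-- Copies are grouped by the set `P` of star vertices sent into `U`, with 2^(r+1) possibilities.
Each vertex outside `P` costs a factor Δ in the count and gains c⁻¹ in the weight, hence a factor
`y` in total; `s ≥ 1` keeps `P` nonempty. -/
lemma sum_star_copies_le {Δ : ℕ} (hΔ : ∀ v, G.degree v ≤ Δ) {c : ℕ+} {y : ℝ} (hy : 1 ≤ y)
    (hyΔ : (Δ : ℝ) ≤ y * c) (U : Finset V) {s : ℕ} (hs : 1 ≤ s) :
    (∑ f : (star r).Copy G, if s ≤ (copyImage f ∩ U).card then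
      ((c : ℝ) ^ (r + 1 - (copyImage f ∩ U).card))⁻¹ else 0) ≤
      2 ^ (r + 1) * ((U.card + 1) ^ (r + 1) * y ^ (r + 1 - s)) := by
  have h0 := color_pos c
  rw [← Finset.sum_fiberwise (s := Finset.univ)
    (g := fun f : (star r).Copy G => Finset.univ.filter fun x => f x ∈ U)]
  have hcard : Fintype.card (Finset (Fin 1 ⊕ Fin r)) = 2 ^ (r + 1) := by
    simp [add_comm]
  have : (2 : ℝ) ^ (r + 1) * ((U.card + 1) ^ (r + 1) * y ^ (r + 1 - s)) =
      ∑ _P : Finset (Fin 1 ⊕ Fin r), ((U.card + 1) ^ (r + 1) * y ^ (r + 1 - s)) := by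
    rw [Finset.sum_const, Finset.card_univ, hcard, nsmul_eq_mul]
    push_cast
    rfl
  rw [this]
  refine Finset.sum_le_sum fun P _ => ?_
  have hle : P.card ≤ r + 1 := by
    refine (Finset.card_le_univ P).trans ?_
    simp [add_comm]
  by_cases hsP : s ≤ P.card
  · have hP : P.Nonempty := Finset.card_pos.1 (by omega)
    have h1 : ∀ f ∈ Finset.univ.filter (fun f : (star r).Copy G =>
        (Finset.univ.filter fun x => f x ∈ U) = P),
        (if s ≤ (copyImage f ∩ U).card then ((c : ℝ) ^ (r + 1 - (copyImage f ∩ U).card))⁻¹ else 0) =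
          ((c : ℝ) ^ (r + 1 - P.card))⁻¹ := by
      intro f hf
      rw [card_copyImage_inter, (Finset.mem_filter.1 hf).2, if_pos hsP]
    rw [Finset.sum_congr rfl h1, Finset.sum_const, nsmul_eq_mul]
    have h2 : ((Finset.univ.filter fun f : (star r).Copy G =>
        (Finset.univ.filter fun x => f x ∈ U) = P).card : ℝ) ≤
        (U.card : ℝ) ^ P.card * (Δ : ℝ) ^ (r + 1 - P.card) := by
      exact_mod_cast card_star_copies_le hΔ U hP
    calc _ ≤ (U.card : ℝ) ^ P.card * (Δ : ℝ) ^ (r + 1 - P.card) *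
          ((c : ℝ) ^ (r + 1 - P.card))⁻¹ := by gcongr
      _ ≤ (U.card : ℝ) ^ P.card * (y * c) ^ (r + 1 - P.card) *
          ((c : ℝ) ^ (r + 1 - P.card))⁻¹ := by gcongr
      _ = (U.card : ℝ) ^ P.card * y ^ (r + 1 - P.card) := by
          rw [mul_pow]; field_simp
      _ ≤ ((U.card : ℝ) + 1) ^ (r + 1) * y ^ (r + 1 - s) := by
          have h3 : (U.card : ℝ) ^ P.card ≤ ((U.card : ℝ) + 1) ^ (r + 1) :=
            (pow_le_pow_left₀ (by positivity) (by linarith) _).trans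
              (pow_le_pow_right₀ (by linarith [Nat.cast_nonneg (α := ℝ) U.card]) hle)
          have h4 : y ^ (r + 1 - P.card) ≤ y ^ (r + 1 - s) := pow_le_pow_right₀ hy (by omega)
          gcongr
  · refine (Finset.sum_nonpos fun f hf => ?_).trans (by positivity)
    rw [card_copyImage_inter, (Finset.mem_filter.1 hf).2, if_neg hsP]

lemma sum_copySet_le {W : Type*} [Fintype W] {H : SimpleGraph W} {F : Finset V → ℝ}
    (hF : ∀ B, 0 ≤ F B) : ∑ q, F (copySet H G q) ≤ ∑ f : H.Copy G, F (copyImage f) := by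
  rw [sum_copy_eq F]
  exact le_mul_of_one_le_left (Finset.sum_nonneg fun q _ => hF _)
    (by exact_mod_cast card_iso_pos H)

lemma card_copySet_star (q : CopyClass (star r) G) : (copySet (star r) G q).card = r + 1 := by
  rw [card_copySet]
  simp [add_comm]

lemma sum_wt_star_le {Δ : ℕ} (hΔ : ∀ v, G.degree v ≤ Δ) {c : ℕ+} {y : ℝ} (hy : 1 ≤ y)
    (hyΔ : (Δ : ℝ) ≤ y * c) (U : Finset V) :
    ∑ q, wt c U (copySet (star r) G q) ≤
      countMean (copySet (star r) G) c + 2 ^ (r + 1) * ((U.card + 1) ^ (r + 1) * y ^ r) := by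
  have h0 := color_pos c
  have h1 : countMean (copySet (star r) G) c =
      ∑ _q : CopyClass (star r) G, ((c : ℝ) ^ r)⁻¹ := by
    rw [countMean_eq card_copySet_star]; simp
  have h2 := sum_copySet_le (H := star r) (G := G) (F := fun B => if 1 ≤ (B ∩ U).card then
      ((c : ℝ) ^ (r + 1 - (B ∩ U).card))⁻¹ else 0) fun B => by split_ifs <;> positivity
  have h3 := sum_star_copies_le (r := r) hΔ hy hyΔ U le_rfl
  rw [Nat.add_sub_cancel] at h3
  refine le_trans ?_ (add_le_add h1.ge (h2.trans h3))
  rw [← Finset.sum_add_distrib]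
  refine Finset.sum_le_sum fun q _ => ?_
  have : (0 : ℝ) < ((c : ℝ) ^ r)⁻¹ := by positivity
  rw [wt, card_copySet_star]
  split_ifs with h
  · rw [max_eq_left h]; linarith
  · rw [max_eq_right (by omega), Nat.add_sub_cancel, add_zero]

lemma variance_star_le {Δ : ℕ} (hΔ : ∀ v, G.degree v ≤ Δ) {c : ℕ+} {y : ℝ} (hy : 1 ≤ y)
    (hyΔ : (Δ : ℝ) ≤ y * c) :
    avg (fun X : V → Fin c => (count (copySet (star r) G) X : ℝ) ^ 2) -
      countMean (copySet (star r) G) c ^ 2 ≤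
      countMean (copySet (star r) G) c * (2 ^ (r + 1) * ((r + 2) ^ (r + 1) * y ^ (r - 1))) := by
  have h0 := color_pos c
  refine (variance_le_sum card_copySet_star).trans ?_
  rw [countMean_eq card_copySet_star, mul_assoc, ← nsmul_eq_mul, ← Finset.card_univ,
    ← Finset.sum_const]
  refine Finset.sum_le_sum fun i _ => ?_
  set U := copySet (star r) G i with hU
  have h2 := sum_copySet_le (H := star r) (G := G) (F := fun B => if 2 ≤ (B ∩ U).card then
      ((c : ℝ) ^ (r + 1 - (B ∩ U).card))⁻¹ else 0) fun B => by split_ifs <;> positivity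
  have h3 := sum_star_copies_le (r := r) hΔ hy hyΔ U one_le_two
  have hUc : (U.card : ℝ) + 1 = r + 2 := by
    rw [hU, card_copySet_star]; push_cast; ring
  rw [hUc, show r + 1 - 2 = r - 1 by omega] at h3
  refine le_trans (le_of_eq ?_) (mul_le_mul_of_nonneg_left (h2.trans h3) (by positivity))
  rw [Finset.mul_sum]
  refine Finset.sum_congr rfl fun q _ => ?_
  rw [mul_ite, mul_zero]
  split_ifs with h
  · rw [wt, card_copySet_star, max_eq_left (by omega)]
  · rfl

lemma descFactorial_degree_le (v : V) :
    (G.degree v).descFactorial r ≤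
      Nat.card (star r ≃g star r) * Fintype.card (CopyClass (star r) G) := by
  have h1 := sum_copy_eq (H := star r) (G := G) fun _ => 1
  simp only [Finset.sum_const, nsmul_eq_mul, mul_one, Finset.card_univ] at h1
  have h2 : Fintype.card ((star r).Copy G) =
      Nat.card (star r ≃g star r) * Fintype.card (CopyClass (star r) G) := by exact_mod_cast h1
  rw [← h2]
  have h3 : Fintype.card (Fin r ↪ G.neighborFinset v) = (G.degree v).descFactorial r := by
    rw [Fintype.card_embedding_eq, Fintype.card_coe, Fintype.card_fin]
    rfl
  rw [← h3]
  have hadj : ∀ (s : Fin r ↪ G.neighborFinset v) a, G.Adj v (s a) := fun s a => by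
    have := (s a).2
    rwa [SimpleGraph.mem_neighborFinset] at this
  refine Fintype.card_le_of_injective (fun s => (⟨⟨Sum.elim (fun _ => v) fun a => (s a : V), ?_⟩,
    ?_⟩ : (star r).Copy G)) ?_
  · rintro (a | a) (b | b) hab
    · simp at hab
    · exact hadj s b
    · exact (hadj s a).symm
    · simp at hab
  · rintro (a | a) (b | b) hab
    · rw [Subsingleton.elim a b]
    · exact absurd hab (hadj s b).ne
    · exact absurd hab (hadj s a).ne'
    · have := s.injective (Subtype.ext hab)
      rw [this]
  · intro s t h
    ext a
    exact DFunLike.congr_fun h (Sum.inr a)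

/-- A vertex of maximum degree Δ carries Δ(Δ-1)⋯(Δ-r+1) labelled stars. If Δ > 2r each factor is at
least Δ/2, so (Δ/c)^r is bounded by a multiple of the mean; if Δ ≤ 2r the value 2r serves for both
witnesses. -/
lemma exists_degree_bound (hr : 1 ≤ r) (G : SimpleGraph V) (c : ℕ+) :
    ∃ (Δ : ℕ) (y : ℝ), (∀ v, G.degree v ≤ Δ) ∧ 1 ≤ y ∧ (Δ : ℝ) ≤ y * c ∧
      y ^ r ≤ (2 * r) ^ r +
        2 ^ r * Nat.card (star r ≃g star r) * countMean (copySet (star r) G) c := by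
  have h0 := color_pos c
  have hc1 := one_le_color c
  have hr' : (1 : ℝ) ≤ r := by exact_mod_cast hr
  have hμ := countMean_nonneg (copySet (star r) G) c
  rcases le_or_gt G.maxDegree (2 * r) with h | h
  · refine ⟨2 * r, 2 * r, fun v => (G.degree_le_maxDegree v).trans h, by linarith, ?_, ?_⟩
    · push_cast
      nlinarith
    · have : (0 : ℝ) ≤ 2 ^ r * Nat.card (star r ≃g star r) *
        countMean (copySet (star r) G) c := by positivity
      linarith
  · have hV : Nonempty V := by
      by_contra hV
      rw [not_nonempty_iff] at hV
      rw [SimpleGraph.maxDegree_of_subsingleton] at h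
      omega
    obtain ⟨v, hv⟩ := G.exists_maximal_degree_vertex
    set Δ := G.maxDegree with hΔ
    refine ⟨Δ, max 1 (Δ / c), G.degree_le_maxDegree, le_max_left _ _, ?_, ?_⟩
    · rw [← div_le_iff₀ h0]
      exact le_max_right _ _
    · have h1 : (Δ + 1 - r) ^ r ≤ Nat.card (star r ≃g star r) *
          Fintype.card (CopyClass (star r) G) := by
        refine (Nat.pow_sub_le_descFactorial Δ r).trans ?_
        rw [hv]
        exact descFactorial_degree_le v
      have h2 : Δ ^ r ≤ 2 ^ r * (Nat.card (star r ≃g star r) *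
          Fintype.card (CopyClass (star r) G)) := by
        calc Δ ^ r ≤ (2 * (Δ + 1 - r)) ^ r := Nat.pow_le_pow_left (by omega) r
          _ = 2 ^ r * (Δ + 1 - r) ^ r := mul_pow _ _ _
          _ ≤ _ := Nat.mul_le_mul_left _ h1
      have h3 : (Δ : ℝ) ^ r ≤ 2 ^ r * (Nat.card (star r ≃g star r) *
          Fintype.card (CopyClass (star r) G)) := by exact_mod_cast h2
      have h4 : (Δ / c : ℝ) ^ r ≤ 2 ^ r * Nat.card (star r ≃g star r) *
          countMean (copySet (star r) G) c := by
        rw [div_pow, countMean_eq card_copySet_star, div_eq_mul_inv]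
        calc _ ≤ 2 ^ r * (Nat.card (star r ≃g star r) *
          Fintype.card (CopyClass (star r) G) : ℝ) * ((c : ℝ) ^ r)⁻¹ := by gcongr
          _ = _ := by ring
      have h5 : (1 : ℝ) ≤ (2 * r) ^ r := one_le_pow₀ (by linarith)
      rcases max_cases (1 : ℝ) (Δ / c) with ⟨h6, -⟩ | ⟨h6, -⟩
      · rw [h6, one_pow]
        have : (0 : ℝ) ≤ (Δ / c : ℝ) ^ r := by positivity
        linarith
      · rw [h6]; linarith

end Star

/-! ### The equivalence for stars and convergence of moments -/

section StarLimit

variable {V : ℕ → Type*} [∀ n, Fintype (V n)] {G : ∀ n, SimpleGraph (V n)} {c : ℕ → ℕ+}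
  {l : ℝ≥0} {r : ℕ}

lemma convergesToPoisson_star_of_mean_var (hr : 1 ≤ r) (hc : Tendsto c atTop atTop)
    (hμ : Tendsto (fun n => mean (star r) (G n) (c n)) atTop (𝓝 (l : ℝ)))
    (hv : Tendsto (fun n => var (star r) (G n) (c n)) atTop (𝓝 (l : ℝ))) :
    ConvergesToPoisson (star r) G c l := by
  simp_rw [mean_eq] at hμ
  simp_rw [var_eq] at hv
  refine convergesToPoisson_iff.2
    (tendsto_countProb hr (fun n => card_copySet_star) hc hμ ?_)
  have h1 := (hv.sub (hμ.mul ((tendsto_inv_color_pow hc hr).const_sub 1))).const_mul 2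
  rw [sub_zero, mul_one, sub_self, mul_zero] at h1
  refine squeeze_zero' (Eventually.of_forall fun n => pairSum_nonneg) ?_ h1
  -- The pair sum is at most 2(Var - μ(1 - c^(-r))), which tends to 2(λ - λ) = 0.
  filter_upwards [(tendsto_color hc).eventually_ge_atTop 2] with n hn
  have := pairSum_le_variance (A := copySet (star r) (G n)) (c := c n) card_copySet_star
    (by exact_mod_cast hn)
  linarith

/-- This expresses that y^(r-1) is of lower order than y^r: the coefficient 1/M of y^r can be made
as small as desired. -/
lemma pow_le_pow_add_div {y M : ℝ} (hy : 1 ≤ y) (hM : 1 ≤ M) (hr : 1 ≤ r) :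
    y ^ (r - 1) ≤ M ^ (r - 1) + y ^ r / M := by
  have hM0 : 0 < M := by linarith
  have hy0 : 0 < y := by linarith
  rcases le_total y M with h | h
  · have h1 : y ^ (r - 1) ≤ M ^ (r - 1) := pow_le_pow_left₀ hy0.le h _
    have h2 : 0 ≤ y ^ r / M := by positivity
    linarith
  · have h1 : y ^ (r - 1) ≤ y ^ r / M := by
      rw [le_div_iff₀ hM0]
      calc y ^ (r - 1) * M ≤ y ^ (r - 1) * y := by gcongr
        _ = y ^ r := by rw [← pow_succ]; congr 1; omega
    have h2 : 0 ≤ M ^ (r - 1) := by positivity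
    linarith

/-- The mean number of monochromatic stars is bounded if there is none with probability bounded
away from zero. -/
lemma exists_mean_bound (hr : 1 ≤ r) {δ : ℝ} (hδ : 0 < δ) :
    ∃ B : ℝ, ∀ {V : Type*} [Fintype V] (G : SimpleGraph V) (c : ℕ+),
      δ ≤ countProb (copySet (star r) G) c 0 → countMean (copySet (star r) G) c ≤ B := by
  set C : ℝ := 2 ^ (r + 1) * ((r : ℝ) + 2) ^ (r + 1) with hC
  set K₁ : ℝ := (2 * r) ^ r with hK₁
  set K₂ : ℝ := 2 ^ r * Nat.card (star r ≃g star r) with hK₂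
  have hC0 : 0 < C := by positivity
  have hK₁0 : 0 ≤ K₁ := by positivity
  have hK₂0 : 0 ≤ K₂ := by positivity
  -- Chebyshev will give μδ ≤ C y^(r-1) with y^r ≤ K₁ + K₂ μ. This `M` makes the resulting
  -- coefficient of μ on the right at most δ/2, so that it can be absorbed on the left.
  set M : ℝ := max 1 (2 * C * K₂ / δ) with hM
  have hM1 : 1 ≤ M := le_max_left _ _
  have hM0 : 0 < M := by linarith
  have hM2 : C * K₂ / M ≤ δ / 2 := by
    rw [div_le_iff₀ hM0]
    have : 2 * C * K₂ / δ ≤ M := le_max_right _ _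
    rw [div_le_iff₀ hδ] at this
    linarith
  refine ⟨C * (M ^ (r - 1) + K₁ / M) / (δ / 2), fun {V} _ G c hG => ?_⟩
  obtain ⟨Δ, y, hΔ, hy, hyΔ, hyr⟩ := exists_degree_bound hr G c
  have hμ0 := countMean_nonneg (copySet (star r) G) c
  set μ := countMean (copySet (star r) G) c
  rw [le_div_iff₀ (by positivity)]
  rcases hμ0.eq_or_lt with h0 | h0
  · rw [← h0, zero_mul]
    positivity
  · have h1 := (sq_mul_countProb_zero_le (A := copySet (star r) G) (c := c)).trans
      (variance_star_le hΔ hy hyΔ)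
    have h2 : μ * (μ * δ) ≤ μ * (C * y ^ (r - 1)) := by
      calc μ * (μ * δ) = μ ^ 2 * δ := by ring
        _ ≤ μ ^ 2 * countProb (copySet (star r) G) c 0 := by gcongr
        _ ≤ _ := h1
        _ = _ := by rw [hC]; ring
    have h3 : μ * δ ≤ C * y ^ (r - 1) := le_of_mul_le_mul_left h2 h0
    have h4 : y ^ (r - 1) ≤ M ^ (r - 1) + (K₁ + K₂ * μ) / M := by
      refine (pow_le_pow_add_div hy hM1 hr).trans ?_
      gcongr
    have h5 : C * y ^ (r - 1) ≤ C * (M ^ (r - 1) + K₁ / M) + C * K₂ / M * μ := by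
      calc _ ≤ C * (M ^ (r - 1) + (K₁ + K₂ * μ) / M) := by gcongr
        _ = _ := by ring
    have h6 : C * K₂ / M * μ ≤ δ / 2 * μ := by gcongr
    linarith

/-- All moments of the number of monochromatic stars are bounded in terms of the mean. -/
lemma exists_moment_bound (hr : 1 ≤ r) (B : ℝ) (m : ℕ) :
    ∃ K : ℝ, ∀ {V : Type*} [Fintype V] (G : SimpleGraph V) (c : ℕ+),
      countMean (copySet (star r) G) c ≤ B →
        avg (fun X : V → Fin c => (count (copySet (star r) G) X : ℝ) ^ m) ≤ K := by
  induction m with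
  | zero => exact ⟨1, fun G c _ => by simp [avg_const]⟩
  | succ m ih =>
    obtain ⟨K, hK⟩ := ih
    set L : ℝ := B + 2 ^ (r + 1) * (((m * (r + 1) : ℕ) + 1 : ℝ) ^ (r + 1) *
      ((2 * r) ^ r + 2 ^ r * Nat.card (star r ≃g star r) * B)) with hL
    refine ⟨L * K, fun {V} _ G c hG => ?_⟩
    obtain ⟨Δ, y, hΔ, hy, hyΔ, hyr⟩ := exists_degree_bound hr G c
    have hB : 0 ≤ B := (countMean_nonneg _ _).trans hG
    have h1 : ∀ U : Finset V, U.card ≤ m * (r + 1) →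
        ∑ q, wt c U (copySet (star r) G q) ≤ L := by
      intro U hU
      refine (sum_wt_star_le hΔ hy hyΔ U).trans ?_
      have hy' : y ^ r ≤ (2 * r) ^ r + 2 ^ r * Nat.card (star r ≃g star r) * B :=
        hyr.trans (by gcongr)
      have hU' : (U.card : ℝ) ≤ (m * (r + 1) : ℕ) := by exact_mod_cast hU
      rw [hL]
      gcongr
    refine (avg_count_pow_succ_le card_copySet_star m h1).trans ?_
    have : 0 ≤ L := by positivity
    exact mul_le_mul_of_nonneg_left (hK G c hG) this

lemma ConvergesToPoisson.moments (hr : 1 ≤ r) (h : ConvergesToPoisson (star r) G c l) (m : ℕ) :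
    Tendsto (fun n => avg fun X : V n → Fin (c n) => (count (copySet (star r) (G n)) X : ℝ) ^ m)
      atTop (𝓝 (∑' k : ℕ, (k : ℝ) ^ m * (poissonMeasure l).real {k})) := by
  rw [convergesToPoisson_iff] at h
  have hp0 : 0 < (poissonMeasure l).real {0} := by
    rw [poissonMeasure_real_singleton]
    simp [Real.exp_pos]
  obtain ⟨B, hB⟩ := exists_mean_bound hr (half_pos hp0)
  obtain ⟨K, hK⟩ := exists_moment_bound hr B (m + 2)
  -- The probability of no monochromatic star tends to that of the Poisson law at 0, which is
  -- positive, so it eventually exceeds half of that value.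
  have hev : ∀ᶠ n in atTop, countMean (copySet (star r) (G n)) (c n) ≤ B := by
    filter_upwards [(h 0).eventually (eventually_ge_nhds (half_lt_self hp0))] with n hn
    exact hB _ _ hn
  refine (tendsto_tsum_pow_mul (p := fun n k => countProb (copySet (star r) (G n)) (c n) k) m
    (B := K) (B' := 1) (fun n k => countProb_nonneg _ _ _) ?_
    (Eventually.of_forall fun n k => avg_ind_le_one _) h).1.congr fun n => ?_
  · filter_upwards [hev] with n hn k
    exact (pow_mul_countProb_le _ _ _ _).trans (hK _ _ hn)
  · exact (hasSum_avg_comp (fun X : V n → Fin (c n) => count (copySet (star r) (G n)) X)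
      fun k => (k : ℝ) ^ m).tsum_eq

theorem convergesToPoisson_star_iff (hr : 1 ≤ r) (hc : Tendsto c atTop atTop) :
    ConvergesToPoisson (star r) G c l ↔
      Tendsto (fun n => mean (star r) (G n) (c n)) atTop (𝓝 (l : ℝ)) ∧
      Tendsto (fun n => var (star r) (G n) (c n)) atTop (𝓝 (l : ℝ)) := by
  refine ⟨fun h => ?_, fun h => convergesToPoisson_star_of_mean_var hr hc h.1 h.2⟩
  have h1 := h.moments hr 1
  have h2 := h.moments hr 2
  simp only [pow_one] at h1
  rw [(hasSum_mean_poisson l).tsum_eq] at h1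
  rw [(hasSum_sq_poisson l).tsum_eq] at h2
  simp_rw [mean_eq, var_eq]
  refine ⟨h1, ?_⟩
  have h3 := h2.sub (h1.pow 2)
  rwa [add_sub_cancel_right] at h3

theorem tendsto_moment_star (hr : 1 ≤ r) (h : ConvergesToPoisson (star r) G c l) (m : ℕ) :
    Tendsto (fun n => moment (star r) (G n) (c n) m) atTop
      (𝓝 (∫ k : ℕ, (k : ℝ) ^ m ∂(poissonMeasure l))) := by
  simp_rw [moment_eq]
  rw [integral_poissonMeasure]
  have h1 := h.moments hr m
  simp_rw [poissonMeasure_real_singleton] at h1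
  simp_rw [smul_eq_mul, mul_comm _ ((_ : ℝ) ^ m)]
  exact h1

end StarLimit

/-! ### Injective endomorphisms and a characterization of stars -/

section Graphs

variable {W : Type*} [Fintype W] {H : SimpleGraph W}

lemma eq_of_connected_of_adj {α : Type*} (hH : H.Connected) (f : W → α)
    (hf : ∀ a b, H.Adj a b → f a = f b) (a b : W) : f a = f b := by
  obtain ⟨p⟩ := hH.preconnected a b
  induction p with
  | nil => rfl
  | cons h _ ih => exact (hf _ _ h).trans ih

/-- An injective endomorphism of a finite graph is an automorphism. -/
lemma exists_iso_of_injective (g : W → W) (hg : Function.Injective g)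
    (hadj : ∀ a b, H.Adj a b → H.Adj (g a) (g b)) : ∃ φ : H ≃g H, ∀ x, φ x = g x := by
  -- The induced map on ordered adjacent pairs is injective on a finite set, hence surjective, so
  -- adjacency is also reflected.
  let F : {p : W × W // H.Adj p.1 p.2} → {p : W × W // H.Adj p.1 p.2} := fun p =>
    ⟨(g p.1.1, g p.1.2), hadj _ _ p.2⟩
  have hF : Function.Injective F := by
    rintro ⟨⟨a, b⟩, hab⟩ ⟨⟨a', b'⟩, hab'⟩ h
    have h' := Prod.mk.inj (Subtype.mk.inj h)
    have h1 : a = a' := hg h'.1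
    have h2 : b = b' := hg h'.2
    subst h1 h2
    rfl
  have hs := Finite.injective_iff_surjective.1 hF
  refine ⟨⟨Equiv.ofBijective g (Finite.injective_iff_bijective.1 hg), ?_⟩, fun x => rfl⟩
  intro a b
  refine ⟨fun h => ?_, hadj a b⟩
  obtain ⟨⟨⟨a', b'⟩, hab⟩, h'⟩ := hs ⟨(g a, g b), h⟩
  have h'' := Prod.mk.inj (Subtype.mk.inj h')
  have h1 : a' = a := hg h''.1
  have h2 : b' = b := hg h''.2
  subst h1 h2
  exact hab

/-- A connected graph all of whose edges touch a set of at most one vertex is a star. -/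
lemma exists_iso_star [Nontrivial W] (hH : H.Connected) {S : W → Prop}
    (hS : ∀ a b, S a → S b → a = b) (hadj : ∀ a b, H.Adj a b → S a ∨ S b) :
    ∃ r : ℕ, 1 ≤ r ∧ Nonempty (H ≃g star r) := by
  have hnb : ∀ a, ∃ b, H.Adj a b := fun a => by
    obtain ⟨b, hb⟩ := hH.preconnected.exists_adj_of_nontrivial a
    exact ⟨b, hb⟩
  obtain ⟨x₀, hx₀⟩ : ∃ x, S x := by
    obtain ⟨a⟩ := hH.nonempty
    obtain ⟨b, hb⟩ := hnb a
    rcases hadj _ _ hb with h | h <;> exact ⟨_, h⟩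
  -- Connectedness gives every vertex a neighbor, and that edge must touch `x₀`; so all other
  -- vertices are adjacent to `x₀` and to nothing else.
  have hiff : ∀ a b, H.Adj a b ↔ (a = x₀ ∧ b ≠ x₀) ∨ (b = x₀ ∧ a ≠ x₀) := by
    have h1 : ∀ b, b ≠ x₀ → H.Adj b x₀ := by
      intro b hb
      obtain ⟨c, hc⟩ := hnb b
      rcases hadj _ _ hc with h | h
      · exact absurd (hS _ _ h hx₀) hb
      · rwa [hS _ _ h hx₀] at hc
    intro a b
    constructor
    · intro h
      rcases hadj _ _ h with h' | h'
      · have := hS _ _ h' hx₀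
        subst this
        exact Or.inl ⟨rfl, h.ne'⟩
      · have := hS _ _ h' hx₀
        subst this
        exact Or.inr ⟨rfl, h.ne⟩
    · rintro (⟨rfl, h⟩ | ⟨rfl, h⟩)
      · exact (h1 _ h).symm
      · exact h1 _ h
  let r := Fintype.card {x // x ≠ x₀}
  have e₁ : {x // x = x₀} ≃ Fin 1 := Equiv.ofUnique _ _
  have e₂ : {x // ¬ x = x₀} ≃ Fin r := Fintype.equivFin {x // x ≠ x₀}
  let e : W ≃ Fin 1 ⊕ Fin r := (Equiv.sumCompl fun x => x = x₀).symm.trans (Equiv.sumCongr e₁ e₂)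
  have hl : ∀ a, (e a).isLeft ↔ a = x₀ := by
    intro a
    by_cases h : a = x₀
    · have : e a = Sum.inl (e₁ ⟨a, h⟩) := by
        change Sum.map e₁ e₂ ((Equiv.sumCompl fun x => x = x₀).symm a) = _
        rw [Equiv.sumCompl_symm_apply_of_pos (p := fun x => x = x₀) h]
        rfl
      rw [this]
      exact iff_of_true rfl h
    · have : e a = Sum.inr (e₂ ⟨a, h⟩) := by
        change Sum.map e₁ e₂ ((Equiv.sumCompl fun x => x = x₀).symm a) = _
        rw [Equiv.sumCompl_symm_apply_of_neg (p := fun x => x = x₀) h]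
        rfl
      rw [this]
      exact iff_of_false Bool.false_ne_true h
  refine ⟨r, ?_, ⟨⟨e, ?_⟩⟩⟩
  · obtain ⟨y, hy⟩ := exists_ne x₀
    exact Fintype.card_pos_iff.2 ⟨⟨y, hy⟩⟩
  · intro a b
    rw [hiff, ← hl, ← hl, star, completeBipartiteGraph_adj]
    simp only [ne_eq, ← hl, Bool.not_eq_true, Sum.isLeft_eq_false]
    tauto

end Graphs

/-! ### Copies of a non-star in the pyramid union -/

section Pyramid

variable {W : Type*} [Fintype W] {H : SimpleGraph W} {w : W}

lemma pyramidMap_injective {n : ℕ} (a : Fin n) : Function.Injective (pyramidMap w a) := by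
  intro x y h
  unfold pyramidMap at h
  split_ifs at h with hx hy hy
  · rw [hx, hy]
  · simpa using h

lemma pyramidMap_self {n : ℕ} (a : Fin n) : pyramidMap w a w = Sum.inr a := dif_pos rfl

lemma eq_of_pyramidMap_eq_inr {n : ℕ} {a b : Fin n} {x : W} (h : pyramidMap w a x = Sum.inr b) :
    x = w ∧ a = b := by
  unfold pyramidMap at h
  split_ifs at h with hx
  exact ⟨hx, Sum.inr_injective h⟩

lemma not_pyramid_adj_inr {n : ℕ} (a b : Fin n) :
    ¬ (pyramid H w n).Adj (Sum.inr a) (Sum.inr b) := by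
  rw [pyramid, SimpleGraph.iSup_adj]
  rintro ⟨i, -, x, y, hxy, hx, hy⟩
  rw [(eq_of_pyramidMap_eq_inr hx).1, (eq_of_pyramidMap_eq_inr hy).1] at hxy
  exact hxy.ne rfl

variable (H w) in
/-- The `a`-th of the copies of `H` that form the pyramid. -/
def pyramidCopy (l : ℝ≥0) {n : ℕ} (a : Fin n) : H.Copy (pyramidUnion H w l n) :=
  ⟨⟨fun x => Sum.inl (pyramidMap w a x), fun {x y} h => by
    rw [pyramidUnion, SimpleGraph.sum_adj_inl, pyramid, SimpleGraph.iSup_adj]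
    exact ⟨a, fun h' => h.ne (pyramidMap_injective a h'), x, y, h, rfl, rfl⟩⟩,
    Sum.inl_injective.comp (pyramidMap_injective a)⟩

variable (H w) in
/-- The `j`-th of the disjoint copies of `H`. -/
def disjointCopy (l : ℝ≥0) (n : ℕ) (j : Fin (numCopies l n)) : H.Copy (pyramidUnion H w l n) :=
  ⟨⟨fun x => Sum.inr (j, x), fun {x y} h => by
    rw [pyramidUnion, SimpleGraph.sum_adj_inr]
    exact ⟨rfl, h⟩⟩,
    fun _ _ h => (Prod.mk.inj (Sum.inr_injective h)).2⟩

variable (H w) in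
/-- The vertex sets of the disjoint copies of `H`. -/
def disjointSet (l : ℝ≥0) (n : ℕ) (j : Fin (numCopies l n)) :
    Finset (PyramidVertex w n ⊕ (Fin (numCopies l n) × W)) :=
  copyImage (disjointCopy H w l n j)

variable {l : ℝ≥0} {n : ℕ}

lemma mem_disjointSet {j : Fin (numCopies l n)} {v} :
    v ∈ disjointSet H w l n j ↔ ∃ x, Sum.inr (j, x) = v := mem_copyImage

/-- A copy of a graph other than a star is one of the disjoint copies or contains two base vertices
of the pyramid. -/
lemma copy_cases [Nontrivial W] (hH : H.Connected)
    (hstar : ∀ r : ℕ, 1 ≤ r → IsEmpty (H ≃g star r)) (f : H.Copy (pyramidUnion H w l n)) :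
    (∃ j, ∃ φ : H ≃g H, f = (disjointCopy H w l n j).comp φ.toCopy) ∨
      ∃ a b : {x // x ≠ w}, a ≠ b ∧ Sum.inl (Sum.inl a) ∈ copyImage f ∧
        Sum.inl (Sum.inl b) ∈ copyImage f := by
  have hadj : ∀ a b, H.Adj a b → (pyramidUnion H w l n).Adj (f a) (f b) :=
    fun a b h => f.toHom.map_adj h
  have hside : ∀ a b, (f a).isLeft = (f b).isLeft := by
    refine eq_of_connected_of_adj hH _ fun a b h => ?_
    have h' := hadj a b h
    rcases hu : f a with u | u <;> rcases hv : f b with v | v <;> rw [hu, hv] at h'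
    · rfl
    · simp [pyramidUnion] at h'
    · simp [pyramidUnion] at h'
    · rfl
  obtain ⟨x₀⟩ := hH.nonempty
  rcases hx₀ : f x₀ with u | u
  · right
    have hl : ∀ x, ∃ p, f x = Sum.inl p := by
      intro x
      have := hside x x₀
      rw [hx₀] at this
      exact Sum.isLeft_iff.1 this
    choose p hp using hl
    -- If at most one vertex of the copy lands in the base, every edge touches it, because apices
    -- are pairwise nonadjacent; `H` would then be a star.
    by_contra hcon
    obtain ⟨r, hr, ⟨e⟩⟩ := exists_iso_star hH (S := fun x => (p x).isLeft) (by
      intro a b ha hb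
      obtain ⟨a', ha'⟩ := Sum.isLeft_iff.1 ha
      obtain ⟨b', hb'⟩ := Sum.isLeft_iff.1 hb
      by_contra hab
      refine hcon ⟨a', b', ?_, mem_copyImage.2 ⟨a, by rw [hp, ha']⟩,
        mem_copyImage.2 ⟨b, by rw [hp, hb']⟩⟩
      rintro rfl
      exact hab (f.injective (show f a = f b by rw [hp, hp, ha', hb']))) (by
      intro a b hab
      have h' := hadj a b hab
      rw [hp, hp, pyramidUnion, SimpleGraph.sum_adj_inl] at h'
      rcases ha : p a with a' | a'
      · exact Or.inl rfl
      · rcases hb : p b with b' | b'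
        · exact Or.inr rfl
        · rw [ha, hb] at h'
          exact absurd h' (not_pyramid_adj_inr _ _))
    exact (hstar r hr).false e
  · left
    have hr : ∀ x, ∃ p, f x = Sum.inr p := by
      intro x
      have := hside x x₀
      rw [hx₀] at this
      exact Sum.isRight_iff.1 (by simpa using this)
    choose p hp using hr
    have hadj' : ∀ a b, H.Adj a b → (p a).1 = (p b).1 ∧ H.Adj (p a).2 (p b).2 := by
      intro a b hab
      have h' := hadj a b hab
      rw [hp, hp, pyramidUnion, SimpleGraph.sum_adj_inr] at h'
      exact h'
    have hj := eq_of_connected_of_adj hH (fun x => (p x).1) fun a b h => (hadj' a b h).1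
    -- By connectedness the whole image lies in one disjoint copy, so `f` induces an injective
    -- endomorphism of `H`.
    obtain ⟨φ, hφ⟩ := exists_iso_of_injective (H := H) (fun x => (p x).2)
      (fun a b h => f.injective (show f a = f b by
        rw [hp, hp, Prod.ext (hj a b) h])) fun a b h => (hadj' a b h).2
    refine ⟨(p x₀).1, φ, DFunLike.ext _ _ fun x => ?_⟩
    change f x = Sum.inr ((p x₀).1, φ x)
    rw [hp, hφ, hj x₀ x]

lemma disjointSet_card (j : Fin (numCopies l n)) :
    (disjointSet H w l n j).card = Fintype.card W := card_copyImage _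

/-- A copy with two base vertices is not monochromatic when the base colors are distinct, so only
the disjoint copies remain. Each has |Aut H| labellings, and this factor cancels. -/
lemma count_eq_of_base_injective [Nontrivial W] (hH : H.Connected)
    (hstar : ∀ r : ℕ, 1 ≤ r → IsEmpty (H ≃g star r)) {c : ℕ+}
    {X : PyramidVertex w n ⊕ (Fin (numCopies l n) × W) → Fin c}
    (hX : ∀ a b : {x // x ≠ w}, a ≠ b → X (Sum.inl (Sum.inl a)) ≠ X (Sum.inl (Sum.inl b))) :
    count (copySet H (pyramidUnion H w l n)) X = count (disjointSet H w l n) X := by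
  have := finite_iso H
  have := Fintype.ofFinite (H ≃g H)
  have ha : (Nat.card (H ≃g H) : ℝ) ≠ 0 := by exact_mod_cast (card_iso_pos H).ne'
  have h1 := sum_copy_eq (H := H) (G := pyramidUnion H w l n) fun B => ind (Mono X B)
  rw [← count_cast (copySet H (pyramidUnion H w l n)) X] at h1
  have himage : ∀ j (φ : H ≃g H), copyImage ((disjointCopy H w l n j).comp φ.toCopy) =
      disjointSet H w l n j := fun j φ => (copyImage_eq_of_equiv ⟨φ, fun x => rfl⟩).symm
  have h2 : ∑ q : (H ≃g H) × Fin (numCopies l n), ind (Mono X (disjointSet H w l n q.2)) =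
      ∑ f : H.Copy (pyramidUnion H w l n), ind (Mono X (copyImage f)) := by
    refine Fintype.sum_of_injective
      (fun q : (H ≃g H) × Fin (numCopies l n) => (disjointCopy H w l n q.2).comp q.1.toCopy)
      ?_ _ _ ?_ ?_
    · rintro ⟨φ, j⟩ ⟨ψ, k⟩ h
      have h' : ∀ x, j = k ∧ φ x = ψ x := fun x =>
        Prod.mk.inj (Sum.inr_injective (DFunLike.congr_fun h x))
      obtain ⟨x₀⟩ := hH.nonempty
      rw [(h' x₀).1, RelIso.ext fun x => (h' x).2]
    · intro f hf
      refine ind_false fun hm => ?_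
      rcases copy_cases hH hstar f with ⟨j, φ, h⟩ | ⟨a, b, hab, ha, hb⟩
      · exact hf ⟨(φ, j), h.symm⟩
      · exact hX a b hab (hm _ ha _ hb)
    · rintro ⟨φ, j⟩
      rw [himage]
  rw [← h2, Fintype.sum_prod_type] at h1
  simp only [Finset.sum_const, Finset.card_univ, nsmul_eq_mul] at h1
  rw [← count_cast, ← Nat.card_eq_fintype_card] at h1
  exact_mod_cast (mul_left_cancel₀ ha h1).symm

lemma avg_ind_color_eq {V : Type*} [Fintype V] {c : ℕ+} {u v : V} (h : u ≠ v) :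
    avg (fun X : V → Fin c => ind (X u = X v)) = (c : ℝ)⁻¹ := by
  have h1 : ∀ X : V → Fin c, Mono X {u, v} ↔ X u = X v := fun X => by
    rw [mono_iff (u := v) (by simp)]
    simp
  simp_rw [← h1]
  rw [avg_ind_mono (Finset.insert_nonempty _ _), Finset.card_pair h, pow_one]

/-- The two counts can differ only if two base vertices share a color; a union bound over pairs of
base vertices gives the estimate, uniformly in `n`. -/
lemma abs_countProb_sub_le [Nontrivial W] (hH : H.Connected)
    (hstar : ∀ r : ℕ, 1 ≤ r → IsEmpty (H ≃g star r)) (c : ℕ+) (k : ℕ) :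
    |countProb (copySet H (pyramidUnion H w l n)) c k - countProb (disjointSet H w l n) c k| ≤
      (Fintype.card W : ℝ) ^ 2 * (c : ℝ)⁻¹ := by
  have h0 := color_pos c
  rw [countProb, countProb, ← avg_sub]
  refine (abs_avg_le _).trans ?_
  have h1 : ∀ X : PyramidVertex w n ⊕ (Fin (numCopies l n) × W) → Fin c,
      |ind (count (copySet H (pyramidUnion H w l n)) X = k) -
        ind (count (disjointSet H w l n) X = k)| ≤
      ∑ p : {x // x ≠ w} × {x // x ≠ w}, if p.1 ≠ p.2 then
        ind (X (Sum.inl (Sum.inl p.1)) = X (Sum.inl (Sum.inl p.2))) else 0 := by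
    intro X
    have hnn : ∀ p : {x // x ≠ w} × {x // x ≠ w}, 0 ≤ if p.1 ≠ p.2 then
        ind (X (Sum.inl (Sum.inl p.1)) = X (Sum.inl (Sum.inl p.2))) else 0 := by
      intro p
      split_ifs
      · exact ind_nonneg _
      · exact le_rfl
    by_cases hX : ∀ a b : {x // x ≠ w}, a ≠ b →
        X (Sum.inl (Sum.inl a)) ≠ X (Sum.inl (Sum.inl b))
    · rw [count_eq_of_base_injective hH hstar hX, sub_self, abs_zero]
      exact Finset.sum_nonneg fun p _ => hnn p
    · push Not at hX
      obtain ⟨a, b, hab, hX⟩ := hX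
      have h2 : |ind (count (copySet H (pyramidUnion H w l n)) X = k) -
          ind (count (disjointSet H w l n) X = k)| ≤ 1 := by
        have := ind_nonneg (count (copySet H (pyramidUnion H w l n)) X = k)
        have := ind_nonneg (count (disjointSet H w l n) X = k)
        have := ind_le_one (count (copySet H (pyramidUnion H w l n)) X = k)
        have := ind_le_one (count (disjointSet H w l n) X = k)
        rw [abs_le]
        constructor <;> linarith
      refine h2.trans (le_trans (le_of_eq ?_)
        (Finset.single_le_sum (fun p _ => hnn p) (Finset.mem_univ (a, b))))
      rw [if_pos hab, ind_true hX]
  refine (avg_le_avg h1).trans ?_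
  rw [avg_sum]
  have h2 : ∀ p : {x // x ≠ w} × {x // x ≠ w},
      avg (fun X : PyramidVertex w n ⊕ (Fin (numCopies l n) × W) → Fin c => if p.1 ≠ p.2 then
        ind (X (Sum.inl (Sum.inl p.1)) = X (Sum.inl (Sum.inl p.2))) else 0) ≤ (c : ℝ)⁻¹ := by
    intro p
    by_cases hp : p.1 ≠ p.2
    · simp only [if_pos hp]
      exact (avg_ind_color_eq (by simpa using hp)).le
    · simp only [if_neg hp]
      rw [avg_const]
      positivity
  refine (Finset.sum_le_sum fun p _ => h2 p).trans ?_
  rw [Finset.sum_const, Finset.card_univ, Fintype.card_prod, nsmul_eq_mul, sq]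
  push_cast
  have h3 : (Fintype.card {x // x ≠ w} : ℝ) ≤ Fintype.card W := by
    exact_mod_cast Fintype.card_subtype_le _
  gcongr

lemma pairSum_eq_zero {V ι : Type*} [Fintype V] [Fintype ι] {A : ι → Finset V}
    (hA : ∀ i j v, v ∈ A i → v ∈ A j → i = j) (c : ℕ+) : pairSum A c = 0 := by
  refine Finset.sum_eq_zero fun i _ => Finset.sum_eq_zero fun j _ => if_neg ?_
  rintro ⟨hij, h⟩
  obtain ⟨v, hv⟩ := Finset.card_pos.1 (lt_of_lt_of_le two_pos h)
  obtain ⟨h1, h2⟩ := Finset.mem_inter.1 hv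
  exact hij (hA _ _ _ h1 h2)

lemma pairSum_disjointSet (c : ℕ+) : pairSum (disjointSet H w l n) c = 0 := by
  refine pairSum_eq_zero (fun i j v hi hj => ?_) c
  obtain ⟨x, hx⟩ := mem_disjointSet.1 hi
  obtain ⟨y, hy⟩ := mem_disjointSet.1 hj
  exact (Prod.mk.inj (Sum.inr_injective (hx.trans hy.symm))).1

lemma card_copyClass_ge (H : SimpleGraph W) (w : W) [Nonempty W] (l : ℝ≥0) (n : ℕ) :
    n + numCopies l n ≤ Fintype.card (CopyClass H (pyramidUnion H w l n)) := by
  let g : Fin n ⊕ Fin (numCopies l n) → H.Copy (pyramidUnion H w l n) :=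
    Sum.elim (pyramidCopy H w l) (disjointCopy H w l n)
  -- Apices distinguish the copies in the pyramid and the index distinguishes the disjoint ones.
  -- Different vertex sets give different classes.
  have hg : Function.Injective fun x => copyImage (g x) := by
    have hmem : ∀ a : Fin n, Sum.inl (Sum.inr a) ∈ copyImage (pyramidCopy H w l a) := fun a =>
      mem_copyImage.2 ⟨w, congrArg Sum.inl (pyramidMap_self a)⟩
    have hmem' : ∀ a, Sum.inr (a, w) ∈ copyImage (disjointCopy H w l n a) := fun a =>
      mem_copyImage.2 ⟨w, rfl⟩
    rintro (a | a) (b | b) h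
    · have := hmem a
      rw [show copyImage (pyramidCopy H w l a) = copyImage (pyramidCopy H w l b) from h,
        mem_copyImage] at this
      obtain ⟨x, hx⟩ := this
      rw [(eq_of_pyramidMap_eq_inr (Sum.inl_injective hx)).2]
    · have := hmem a
      rw [show copyImage (pyramidCopy H w l a) = copyImage (disjointCopy H w l n b) from h,
        mem_copyImage] at this
      obtain ⟨x, hx⟩ := this
      exact absurd hx Sum.inr_ne_inl
    · have := hmem b
      rw [← show copyImage (disjointCopy H w l n a) = copyImage (pyramidCopy H w l b) from h,
        mem_copyImage] at this
      obtain ⟨x, hx⟩ := this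
      exact absurd hx Sum.inr_ne_inl
    · have := hmem' a
      rw [show copyImage (disjointCopy H w l n a) = copyImage (disjointCopy H w l n b) from h,
        mem_copyImage] at this
      obtain ⟨x, hx⟩ := this
      rw [(Prod.mk.inj (Sum.inr_injective hx)).1]
  have h1 := Fintype.card_le_of_injective
    (fun x => (Quotient.mk (copySetoid H (pyramidUnion H w l n)) (g x) :
      CopyClass H (pyramidUnion H w l n)))
    fun x y h => hg (copyImage_eq_of_equiv (Quotient.exact h))
  rw [Fintype.card_sum, Fintype.card_fin, Fintype.card_fin] at h1
  exact h1

end Pyramid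

/-! ### Choice of the number of colors and the counterexample -/

section PyramidLimit

/-- The integer part of the `r`-th root of `n`, or `1` if `n = 0`. -/
def rootColor (r n : ℕ) : ℕ+ := (Nat.findGreatest (fun b => (b + 1) ^ r ≤ n) n).succPNat

lemma rootColor_pow_le {r n : ℕ} (hn : 1 ≤ n) : (rootColor r n : ℕ) ^ r ≤ n := by
  have := Nat.findGreatest_spec (P := fun b => (b + 1) ^ r ≤ n) (Nat.zero_le n) (by simpa using hn)
  simpa [rootColor] using this

lemma lt_rootColor_succ_pow {r n : ℕ} (hr : 1 ≤ r) : n < ((rootColor r n : ℕ) + 1) ^ r := by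
  rw [rootColor, Nat.succPNat_coe, Nat.succ_eq_add_one]
  set m := Nat.findGreatest (fun b => (b + 1) ^ r ≤ n) n with hm
  by_contra! h
  have h1 : m + 1 ≤ n := by
    have := Nat.le_self_pow (n := r) (by omega) (m + 1 + 1)
    omega
  exact Nat.findGreatest_is_greatest (P := fun b => (b + 1) ^ r ≤ n)
    (hm ▸ Nat.lt_succ_self m) h1 h

lemma tendsto_rootColor {r : ℕ} (hr : 1 ≤ r) : Tendsto (rootColor r) atTop atTop := by
  rw [tendsto_atTop]
  intro b
  filter_upwards [eventually_ge_atTop ((b : ℕ) ^ r)] with n hn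
  have h1 := lt_rootColor_succ_pow (n := n) hr
  have h2 : (b : ℕ) < (rootColor r n : ℕ) + 1 := lt_of_pow_lt_pow_left₀ r (by omega) (hn.trans_lt h1)
  exact PNat.coe_le_coe _ _ |>.1 (by omega)

lemma tendsto_div_rootColor_pow {r : ℕ} (hr : 1 ≤ r) :
    Tendsto (fun n : ℕ => (n : ℝ) * (((rootColor r n : ℕ) : ℝ) ^ r)⁻¹) atTop (𝓝 1) := by
  have hc := tendsto_color (tendsto_rootColor hr)
  -- From c^r ≤ n < (c+1)^r the ratio n / c^r lies between 1 and (1 + 1/c)^r.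
  have h1 : Tendsto (fun n : ℕ => (1 + ((rootColor r n : ℕ) : ℝ)⁻¹) ^ r) atTop (𝓝 1) := by
    have := (hc.inv_tendsto_atTop.const_add 1).pow r
    simpa using this
  refine tendsto_of_tendsto_of_tendsto_of_le_of_le' tendsto_const_nhds h1 ?_ ?_
  · filter_upwards [eventually_ge_atTop 1] with n hn
    have h0 := color_pos (rootColor r n)
    rw [← div_eq_mul_inv, le_div_iff₀ (by positivity), one_mul]
    exact_mod_cast rootColor_pow_le hn
  · filter_upwards with n
    have h0 := color_pos (rootColor r n)
    rw [← div_eq_mul_inv, div_le_iff₀ (by positivity), ← mul_pow, add_mul, one_mul,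
      inv_mul_cancel₀ h0.ne']
    exact_mod_cast (lt_rootColor_succ_pow hr).le

variable {W : Type*} [Fintype W] [Nontrivial W] {H : SimpleGraph W}

lemma card_eq_pred_add_one : Fintype.card W = (Fintype.card W - 1) + 1 := by
  have := Fintype.card_pos (α := W)
  omega

lemma one_le_card_pred : 1 ≤ Fintype.card W - 1 := by
  have := Fintype.one_lt_card (α := W)
  omega

theorem convergesToPoisson_pyramidUnion (hH : H.Connected)
    (hstar : ∀ r : ℕ, 1 ≤ r → IsEmpty (H ≃g star r)) (l : ℝ≥0) (w : W) :
    ConvergesToPoisson H (pyramidUnion H w l) (rootColor (Fintype.card W - 1)) l := by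
  have hr := one_le_card_pred (W := W)
  set r := Fintype.card W - 1 with hrdef
  have hcard : ∀ n j, (disjointSet H w l n j).card = r + 1 := fun n j =>
    (disjointSet_card j).trans card_eq_pred_add_one
  have hc := tendsto_rootColor hr
  have hμ : Tendsto (fun n => countMean (disjointSet H w l n) (rootColor r n)) atTop
      (𝓝 (l : ℝ)) := by
    -- The mean of the disjoint part is ⌈λn⌉ / c^r, the product of ⌈λn⌉ / n → λ and n / c^r → 1.
    have h1 := ((tendsto_nat_ceil_mul_div_atTop l.coe_nonneg).comp
      (tendsto_natCast_atTop_atTop (R := ℝ))).mul (tendsto_div_rootColor_pow hr)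
    rw [mul_one] at h1
    refine h1.congr' ?_
    filter_upwards [eventually_ge_atTop 1] with n hn
    have hn0 : (n : ℝ) ≠ 0 := by exact_mod_cast (by omega : n ≠ 0)
    rw [countMean_eq (hcard n), Fintype.card_fin]
    simp only [Function.comp]
    field_simp
  refine convergesToPoisson_iff.2 fun k => ?_
  have h1 := tendsto_countProb hr hcard hc hμ (by simp [pairSum_disjointSet]) k
  have h2 : Tendsto (fun n => countProb (copySet H (pyramidUnion H w l n)) (rootColor r n) k -
      countProb (disjointSet H w l n) (rootColor r n) k) atTop (𝓝 0) := by
    have h3 := (tendsto_color hc).inv_tendsto_atTop.const_mul ((Fintype.card W : ℝ) ^ 2)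
    rw [mul_zero] at h3
    exact squeeze_zero_norm (fun n => abs_countProb_sub_le hH hstar _ k) h3
  have h3 := h2.add h1
  rw [zero_add] at h3
  exact h3.congr fun n => sub_add_cancel _ _

theorem not_tendsto_mean_pyramidUnion (H : SimpleGraph W) (l : ℝ≥0) (w : W) :
    ¬ Tendsto (fun n => mean H (pyramidUnion H w l n) (rootColor (Fintype.card W - 1) n)) atTop
      (𝓝 (l : ℝ)) := by
  set r := Fintype.card W - 1 with hrdef
  intro h
  -- At least n + ⌈λn⌉ copies exist, and c^r ≤ n, so the mean exceeds the candidate limit by at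
  -- least 1.
  have h1 : ∀ᶠ n in atTop, (1 + l : ℝ) ≤ mean H (pyramidUnion H w l n) (rootColor r n) := by
    filter_upwards [eventually_ge_atTop 1] with n hn
    have h0 := color_pos (rootColor r n)
    rw [mean_eq, countMean_eq fun q => (card_copySet q).trans card_eq_pred_add_one,
      ← div_eq_mul_inv, le_div_iff₀ (by positivity)]
    have h2 : ((rootColor r n : ℕ) : ℝ) ^ r ≤ n := by exact_mod_cast rootColor_pow_le hn
    have h3 : (n : ℝ) + numCopies l n ≤
        Fintype.card (CopyClass H (pyramidUnion H w l n)) := by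
      exact_mod_cast card_copyClass_ge H w l n
    have h4 : (l : ℝ) * n ≤ numCopies l n := Nat.le_ceil _
    calc (1 + l : ℝ) * ((rootColor r n : ℕ) : ℝ) ^ r ≤ (1 + l) * n := by gcongr
      _ ≤ _ := by linarith
  have h2 := ge_of_tendsto h h1
  linarith

end PyramidLimit

end MonoCopies

end

theorem theorem1p2 :
    -- Stars: Poisson convergence is equivalent to convergence of mean and variance to `l`, and
    -- it entails the convergence of all moments.
    (∀ (r : ℕ), 1 ≤ r → ∀ (l : ℝ≥0) (V : ℕ → Type*) [∀ n, Fintype (V n)]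
      (G : ∀ n, SimpleGraph (V n)) (c : ℕ → ℕ+), Tendsto c atTop atTop →
        (MonoCopies.ConvergesToPoisson (MonoCopies.star r) G c l ↔
          Tendsto (fun n => MonoCopies.mean (MonoCopies.star r) (G n) (c n)) atTop (𝓝 (l : ℝ)) ∧
          Tendsto (fun n => MonoCopies.var (MonoCopies.star r) (G n) (c n)) atTop (𝓝 (l : ℝ))) ∧
        (MonoCopies.ConvergesToPoisson (MonoCopies.star r) G c l →
          ∀ m : ℕ, Tendsto (fun n => MonoCopies.moment (MonoCopies.star r) (G n) (c n) m) atTop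
            (𝓝 (∫ k : ℕ, (k : ℝ) ^ m ∂(poissonMeasure l))))) ∧
    -- Every other connected graph with at least two vertices: Poisson convergence without
    -- convergence of the mean.
    (∀ (W : Type*) [Fintype W] [Nontrivial W] (H : SimpleGraph W), H.Connected →
      (∀ r : ℕ, 1 ≤ r → IsEmpty (H ≃g MonoCopies.star r)) → ∀ (l : ℝ≥0) (w : W),
        Tendsto (fun n => Fintype.card
          (MonoCopies.PyramidVertex w n ⊕ (Fin (MonoCopies.numCopies l n) × W))) atTop atTop ∧
        ∃ c : ℕ → ℕ+, Tendsto c atTop atTop ∧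
          MonoCopies.ConvergesToPoisson H (MonoCopies.pyramidUnion H w l) c l ∧
          ¬ Tendsto (fun n => MonoCopies.mean H (MonoCopies.pyramidUnion H w l n) (c n)) atTop
            (𝓝 (l : ℝ))) := by

  refine ⟨fun r hr l V _ G c hc => ⟨MonoCopies.convergesToPoisson_star_iff hr hc,
    fun h m => MonoCopies.tendsto_moment_star hr h m⟩, fun W _ _ H hH hstar l w => ⟨?_, ?_⟩⟩
  · refine tendsto_atTop_mono (fun n => ?_) tendsto_id
    have h := Fintype.card_le_of_injective
      (fun a : Fin n => (Sum.inl (Sum.inr a) :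
        MonoCopies.PyramidVertex w n ⊕ (Fin (MonoCopies.numCopies l n) × W)))
      (Sum.inl_injective.comp Sum.inr_injective)
    rw [Fintype.card_fin] at h
    exact h
  · exact ⟨MonoCopies.rootColor (Fintype.card W - 1),
      MonoCopies.tendsto_rootColor MonoCopies.one_le_card_pred,
      MonoCopies.convergesToPoisson_pyramidUnion hH hstar l w,
      MonoCopies.not_tendsto_mean_pyramidUnion H l w⟩
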